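/- **Setting.** There are $n$ agents. Agent $i$ has a standard Borel space $\mathcal T_i$ of types; $\mathcal T=\mathcal T_1\times\dots\times\mathcal T_n$. $\mathcal X$ is the measurable space of allocations, and $v_i:\mathcal T_i\times\mathcal X\to[0,H]$ ($H>0$) are measurable valuations. Any agent can be left out: for each $i$ there is a measurable map $\mathcal X\to\mathcal X$, $A\mapsto A^{\setminus i}$ (agent $i$ receives nothing) with $v_i(t_i,A^{\setminus i})=0$ and $v_j(t_j,A^{\setminus i})=v_j(t_j,A)$ for $j\ne i$. A mechanism $\mathcal M=(x,p)$ consists of a measurable randomized allocation rule $x:\mathcal T\to\Delta(\mathcal X)$ and measurable payments $p:\mathcal T\to[-H,H]^n$. The utility of agent $i$ with type $t_i$ when the reports are $b$ is $t_i(\mathcal M(b))=\mathbb E_{A\sim x(b)}[v_i(t_i,A)]-p_i(b)$, and $u_i^{\mathcal M}(t_i\leftarrow t_i',t_{-i})=t_i(\mathcal M(t_i,t_{-i}))-t_i(\mathcal M(t_i',t_{-i}))$. $\mathcal M$ is *ex-post IR* if $t_i(\mathcal M(t))\ge 0$ for all $i$ and $t\in\mathcal T$. For a probability distribution $\mathcal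 D$ on $\mathcal T$ with marginals $\mathcal D_i$ and conditional distributions $\mathcal D_{-i}|t_i$, $\mathcal M$ is *BIC* w.r.t. $\mathcal D$ if for every $i$ and $\mathcal D_i$-almost every $t_i$, $\mathbb E_{t_{-i}\sim\mathcal D_{-i}|t_i}[u_i^{\mathcal M}(t_i\leftarrow t_i',t_{-i})]\ge 0$ for all $t_i'\in\mathcal T_i$; it is *$(\varepsilon,q)$-BIC* w.r.t. $\mathcal D$ if for every $i$, with probability at least $1-q$ over $t_i\sim\mathcal D_i$, $\mathbb E_{t_{-i}\sim\mathcal D_{-i}|t_i}[u_i^{\mathcal M}(t_i\leftarrow t_i',t_{-i})]\ge-\varepsilon$ for all $t_i'\in\mathcal T_i$ (that is, the types where this fails have outer $\mathcal D_i$-measure at most $q$). Let $Rev(\mathcal M,\mathcal D)=\mathbb E_{t\sim\mathcal D}\big[\sum_i p_i(t)\big]$, let $OPT(\mathcal D)$ be the supremum of $Rev(\mathcal M,\mathcal D)$ over all mechanisms that are ex-post IR and BIC w.r.t. $\mathcal D$, and let $V=2nH$ be the length of the range $[-nH,nH]$ of the revenue. Finally $d_{\mathsf{TV}}(P,Q)=\sup_E|P(E)-Q(E)|$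 over measurable events $E$. **Theorem.** There is an absolute constant $C$ such that the following holds in every such setting. Let $\mathcal D$ be a probability distribution on $\mathcal T$, let $\mathcal D^p$ be a product probability distribution on $\mathcal T$ with $d_{\mathsf{TV}}(\mathcal D,\mathcal D^p)\le\delta$, let $\alpha\ge 0$, and let $\mathcal M$ be a mechanism that is ex-post IR and BIC w.r.t. $\mathcal D^p$ with $Rev(\mathcal M,\mathcal D^p)\ge\alpha\,OPT(\mathcal D^p)$. Then $\mathcal M$ is ex-post IR and $\left(\frac{8H\delta}{q},q\right)$-BIC w.r.t. $\mathcal D$ for every $q\in(0,1]$. Furthermore, if for each $i$ the set of functions $\{v_i(t_i,\cdot):t_i\in\mathcal T_i\}$ is separable in the supremum norm on $\mathcal X$ (which is automatic when $\mathcal X$ is finite or $\mathcal T_i$ is countable), then $$Rev(\mathcal M,\mathcal D)\ \ge\ \alpha\,OPT(\mathcal D)-C\,(1+\alpha)\,V\sqrt{n\sqrt\delta}.$$ -/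

import Mathlib

open MeasureTheory ProbabilityTheory

universe u v

/-- Total variation distance `sup_E |P(E) - Q(E)|` over measurable events `E`. -/
noncomputable def tvDist {Ω : Type*} [MeasurableSpace Ω] (P Q : Measure Ω) : ℝ :=
  ⨆ E : {E : Set Ω // MeasurableSet E}, |P.real E.1 - Q.real E.1|

/-- A mechanism design environment with `n` agents, type spaces `T i`, allocation space `X`,
and valuations with values in `[0, H]`. An allocation describes what all agents receive;
`without i A` is the allocation `A` changed so that agent `i` receives nothing (as when `i` does
not participate), while every other agent receives the same as in `A`. -/
structure Environment {n : ℕ} (T : Fin n → Type u) [∀ i, MeasurableSpace (T i)]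
    (X : Type v) [MeasurableSpace X] (H : ℝ) where
  val : ∀ i, T i → X → ℝ
  measurable_val : ∀ i, Measurable fun z : T i × X => val i z.1 z.2
  val_nonneg : ∀ i t A, 0 ≤ val i t A
  val_le : ∀ i t A, val i t A ≤ H
  without : Fin n → X → X
  measurable_without : ∀ i, Measurable (without i)
  val_without_self : ∀ i t A, val i t (without i A) = 0
  val_without_of_ne : ∀ i j, j ≠ i → ∀ t A, val j t (without i A) = val j t A

/-- A mechanism `(x, p)`: a randomized allocation rule and payments in `[-H, H]`. -/
structure Mechanism {n : ℕ} (T : Fin n → Type u) [∀ i, MeasurableSpace (T i)]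
    (X : Type v) [MeasurableSpace X] (H : ℝ) where
  alloc : Kernel (∀ i, T i) X
  isMarkovKernel_alloc : IsMarkovKernel alloc
  pay : (∀ i, T i) → Fin n → ℝ
  measurable_pay : ∀ i, Measurable fun t => pay t i
  pay_mem : ∀ t i, pay t i ∈ Set.Icc (-H) H

section

variable {n : ℕ} {T : Fin n → Type u} [∀ i, MeasurableSpace (T i)]
  {X : Type v} [MeasurableSpace X] {H : ℝ}

/-- For every agent, the valuation functions `val i t`, `t : T i`, form a separable set of
functions on `X` in the supremum norm. This is automatic if `T i` is countable or `X` is finite. -/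
def Environment.SeparableValuations (E : Environment T X H) : Prop :=
  ∀ i, ∀ κ : ℝ, 0 < κ → ∃ S : Set (T i), S.Countable ∧
    ∀ t, ∃ s ∈ S, ∀ A, |E.val i t A - E.val i s A| ≤ κ

/-- Utility of agent `i` with true type `ti` for the outcome of the mechanism on reports `b`. -/
noncomputable def Mechanism.utility (M : Mechanism T X H) (E : Environment T X H)
    (i : Fin n) (ti : T i) (b : ∀ i, T i) : ℝ :=
  (∫ A, E.val i ti A ∂(M.alloc b)) - M.pay b i

/-- Ex-post individual rationality. -/
def Mechanism.IsExPostIR (M : Mechanism T X H) (E : Environment T X H) : Prop :=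
  ∀ (i : Fin n) (t : ∀ i, T i), 0 ≤ M.utility E i (t i) t

/-- Utility of agent `i` of type `ti` under truthful reporting minus her utility when she
reports `wi` instead, the others reporting as in `t` (the coordinate `t i` is not used). -/
noncomputable def Mechanism.utilityDiff (M : Mechanism T X H) (E : Environment T X H)
    (i : Fin n) (ti wi : T i) (t : ∀ i, T i) : ℝ :=
  M.utility E i ti (Function.update t i ti) - M.utility E i ti (Function.update t i wi)

/-- Expected revenue under truthful reporting. -/
noncomputable def Mechanism.rev (M : Mechanism T X H) (D : Measure (∀ i, T i)) : ℝ :=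
  ∫ t, ∑ i, M.pay t i ∂D

variable [∀ i, StandardBorelSpace (T i)] [∀ i, Nonempty (T i)]

/-- The expectation of `utilityDiff` over the others' types, drawn from the regular conditional
distribution of the type profile under `D` given that agent `i` has type `ti`. -/
noncomputable def Mechanism.interimDiff (M : Mechanism T X H) (E : Environment T X H)
    (D : Measure (∀ i, T i)) [IsProbabilityMeasure D] (i : Fin n) (ti wi : T i) : ℝ :=
  ∫ t, M.utilityDiff E i ti wi t ∂(condDistrib (fun t : ∀ i, T i => t) (fun t => t i) D ti)

/-- Bayesian incentive compatibility with respect to `D`: for every agent and every type (up to a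
null set of the marginal of `D`, as conditional distributions are only defined up to null sets),
no misreport is profitable. -/
def Mechanism.IsBIC (M : Mechanism T X H) (E : Environment T X H)
    (D : Measure (∀ i, T i)) [IsProbabilityMeasure D] : Prop :=
  ∀ i, ∀ᵐ ti ∂(D.map fun t => t i), ∀ wi : T i, 0 ≤ M.interimDiff E D i ti wi

/-- `(ε, q)`-BIC with respect to `D`: with probability at least `1 - q` over her type, an agent
gains at most `ε` from any misreport. The exceptional set of types is the same for all misreports;
its size is measured by the outer measure of the marginal. -/
def Mechanism.IsApproxBIC (M : Mechanism T X H) (E : Environment T X H)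
    (D : Measure (∀ i, T i)) [IsProbabilityMeasure D] (ε q : ℝ) : Prop :=
  ∀ i, (D.map fun t => t i).real {ti | ¬ ∀ wi : T i, -ε ≤ M.interimDiff E D i ti wi} ≤ q

/-- The optimal (supremal) expected revenue under `D` over all ex-post IR mechanisms that are BIC
with respect to `D`. -/
noncomputable def Environment.opt (E : Environment T X H)
    (D : Measure (∀ i, T i)) [IsProbabilityMeasure D] : ℝ :=
  sSup {r | ∃ M : Mechanism T X H, M.IsExPostIR E ∧ M.IsBIC E D ∧ M.rev D = r}

end

/-!
Both parts of the theorem compare a distribution `P` with a nearby one `Q` through densities `a`,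
`b` with respect to a common measure.

*Incentives.* Given her type `s`, the interim incentive of an agent under `P` is, up to
normalization, a conditional mean of `a * utilityDiff`, and it is nonnegative; so for every
misreport the one under `Q`, weighted by the marginal density, is at least `-3 * H` times the
conditional mean of `|a - b|`. The latter does not depend on the misreport and
has total mass at most `2 * tvDist P Q`, and Markov's inequality bounds the mass of the types for
which it is large (`Mechanism.IsBIC.isApproxBIC_of_tvDist_le`).

*Revenue.* The revenue of a fixed mechanism is a Lipschitz function of the distribution, so what
remains is that `opt` drops only slightly from `D` to a nearby product distribution
(`Environment.opt_le_opt_pi`). A mechanism that is incentive compatible for `D` is `(ε, q)`-BIC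
for the product distribution by the first part, and it has to be made exactly incentive compatible
there (`Mechanism.exists_isBIC_of_isApproxBIC`). This is done for one agent at a time
(`exists_incentive_remap`).

* Let `V t s` and `P s` be the interim value and payment of a type `t` who reports `s`. Payments
  are discounted by a factor `1 - η`, and a type may leave, receiving and paying nothing. Types
  bid for the reports `s` of other types; if these are assigned in a measure preserving way, then
  the other agents do not notice (`Environment.interimValue_reassign_of_ne`), which is where
  independence enters.
* By separability there are finitely many cells of types with nearly the same value function
  (`exists_cells_of_separable`). Cells are assigned by softmax demand at prices that clear the
  market (`exists_clearing_prices`), and within a cell the report is drawn at random. The softmax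
  lottery is the optimal choice for expected utility minus relative entropy, so charging the price
  plus the entropy cost makes truth-telling exactly optimal; the transfers have nonnegative mean,
  and the welfare loss is at most the temperature times the number of cells
  (`exists_typeRemap_of_cells`).
* The welfare attained is nearly that of truth-telling at discounted payments, whereas approximate
  incentive compatibility bounds the welfare of any measure preserving assignment. The rebate `η`
  separates the two bounds: it is not collected where a type leaves, so the payments lost in this
  way are at most `(ε + 2 * H * q + κ) / η` on average, with `κ` an arbitrarily small error. So
  the revenue lost is of order `η + (ε + q) / η`.
* As the other reports are independent of her type, an agent only cares about interim payments,
  and these can be charged in an ex-post individually rational way in proportion to the realized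
  value (`Environment.exists_mechanism_of_interimPay`).

With `q = √δ`, `ε = 8 * H * √δ` and `η = √q`, the loss is of order `n * H * √√δ`.
-/

/-! ### Softmax demand and market clearing prices -/

section Prices

variable {S : Type*} [MeasurableSpace S] {ι : Type*} [Fintype ι]

lemma integrable_of_measurable_of_abs_le {μ : Measure S} [IsFiniteMeasure μ] {f : S → ℝ}
    (hf : Measurable f) {C : ℝ} (hC : ∀ x, |f x| ≤ C) : Integrable f μ :=
  Integrable.of_bound hf.aestronglyMeasurable C (Filter.Eventually.of_forall hC)

/-- The partition function of the softmax choice rule with base weights `m` and prices `p`, for an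
agent whose utility from option `c` is `u c`. -/
noncomputable def softmaxSum (m u p : ι → ℝ) : ℝ := ∑ c, m c * Real.exp (u c - p c)

lemma softmaxSum_pos {m : ι → ℝ} (hm : ∀ c, 0 ≤ m c) (h1 : ∑ c, m c = 1) (u p : ι → ℝ) :
    0 < softmaxSum m u p := by
  have h : ∃ c ∈ Finset.univ, 0 < m c := by
    by_contra! h
    have : ∑ c, m c ≤ 0 := Finset.sum_nonpos fun c hc => h c hc
    linarith
  obtain ⟨c, hc, hmc⟩ := h
  exact Finset.sum_pos' (fun c _ => mul_nonneg (hm c) (Real.exp_pos _).le)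
    ⟨c, hc, mul_pos hmc (Real.exp_pos _)⟩

/-- Jensen's inequality for the partition function. -/
lemma sum_le_log_softmaxSum {m : ι → ℝ} (hm : ∀ c, 0 ≤ m c) (h1 : ∑ c, m c = 1) (u p : ι → ℝ) :
    ∑ c, m c * (u c - p c) ≤ Real.log (softmaxSum m u p) := by
  rw [Real.le_log_iff_exp_le (softmaxSum_pos hm h1 u p)]
  have := convexOn_exp.map_sum_le (t := Finset.univ) (w := m) (p := fun c => u c - p c)
    (fun c _ => hm c) h1 (fun c _ => Set.mem_univ _)
  simpa [softmaxSum] using this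

lemma log_add_le_log_softmaxSum {m : ι → ℝ} (hm : ∀ c, 0 ≤ m c) (u p : ι → ℝ) {c : ι}
    (hc : 0 < m c) : Real.log (m c) + (u c - p c) ≤ Real.log (softmaxSum m u p) := by
  have h : m c * Real.exp (u c - p c) ≤ softmaxSum m u p :=
    Finset.single_le_sum (f := fun c => m c * Real.exp (u c - p c))
      (fun c _ => mul_nonneg (hm c) (Real.exp_pos _).le) (Finset.mem_univ c)
  have := Real.log_le_log (by positivity) h
  rwa [Real.log_mul hc.ne' (Real.exp_pos _).ne', Real.log_exp] at this

lemma softmaxSum_le_exp_mul {m : ι → ℝ} (hm : ∀ c, 0 ≤ m c) {u p u' p' : ι → ℝ} {b : ℝ}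
    (h : ∀ c, u c - p c ≤ b + (u' c - p' c)) :
    softmaxSum m u p ≤ Real.exp b * softmaxSum m u' p' := by
  unfold softmaxSum
  rw [Finset.mul_sum]
  refine Finset.sum_le_sum fun c _ => ?_
  rw [mul_left_comm, ← Real.exp_add]
  exact mul_le_mul_of_nonneg_left (Real.exp_le_exp.2 (h c)) (hm c)

lemma log_softmaxSum_le_add {m : ι → ℝ} (hm : ∀ c, 0 ≤ m c) (h1 : ∑ c, m c = 1)
    {u p u' p' : ι → ℝ} {b : ℝ} (h : ∀ c, u c - p c ≤ b + (u' c - p' c)) :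
    Real.log (softmaxSum m u p) ≤ b + Real.log (softmaxSum m u' p') := by
  have := Real.log_le_log (softmaxSum_pos hm h1 u p) (softmaxSum_le_exp_mul hm h)
  rwa [Real.log_mul (Real.exp_pos _).ne' (softmaxSum_pos hm h1 u' p').ne', Real.log_exp] at this

lemma abs_log_softmaxSum_le {m : ι → ℝ} (hm : ∀ c, 0 ≤ m c) (h1 : ∑ c, m c = 1)
    {u p : ι → ℝ} {b : ℝ} (h : ∀ c, |u c - p c| ≤ b) :
    |Real.log (softmaxSum m u p)| ≤ b := by
  have h0 : softmaxSum m 0 0 = 1 := by simp [softmaxSum, h1]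
  have k1 := log_softmaxSum_le_add hm h1 (u := u) (p := p) (u' := 0) (p' := 0) (b := b)
    (fun c => by simpa using (abs_le.1 (h c)).2)
  have k2 := log_softmaxSum_le_add hm h1 (u := 0) (p := 0) (u' := u) (p' := p) (b := b)
    (fun c => by have := (abs_le.1 (h c)).1; simp only [Pi.zero_apply]; linarith)
  rw [h0, Real.log_one] at k1 k2
  rw [abs_le]; constructor <;> linarith

lemma measurable_softmaxSum {u : S → ι → ℝ} (hu : ∀ c, Measurable fun t => u t c)
    (m p : ι → ℝ) : Measurable fun t => softmaxSum m (u t) p := by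
  unfold softmaxSum
  fun_prop

/-- The convex potential whose minimizers are the market clearing prices. The square of the mean
price makes the minimizer satisfy the normalization `∑ c, m c * p c = 0`. -/
noncomputable def pricePotential (μ : Measure S) (m : ι → ℝ) (u : S → ι → ℝ) (p : ι → ℝ) : ℝ :=
  (∫ t, Real.log (softmaxSum m (u t) p) ∂μ) + ∑ c, m c * p c + (∑ c, m c * p c) ^ 2

variable {μ : Measure S} [IsProbabilityMeasure μ]

lemma integrable_log_softmaxSum {m : ι → ℝ} (hm : ∀ c, 0 ≤ m c) (h1 : ∑ c, m c = 1)
    {u : S → ι → ℝ} (hu : ∀ c, Measurable fun t => u t c) {B : ℝ}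
    (hB : ∀ t c, u t c ∈ Set.Icc 0 B) (p : ι → ℝ) :
    Integrable (fun t => Real.log (softmaxSum m (u t) p)) μ := by
  refine integrable_of_measurable_of_abs_le (measurable_softmaxSum hu m p).log
    (C := B + ∑ c, |p c|) fun t => abs_log_softmaxSum_le hm h1 fun c => ?_
  have h2 : |p c| ≤ ∑ c, |p c| :=
    Finset.single_le_sum (f := fun c => |p c|) (fun c _ => abs_nonneg _) (Finset.mem_univ c)
  have h3 := hB t c
  calc |u t c - p c| ≤ |u t c| + |p c| := abs_sub _ _
    _ ≤ _ := by rw [abs_of_nonneg h3.1]; linarith [h3.2]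

lemma exists_min_pricePotential {m : ι → ℝ} (hm : ∀ c, 0 < m c) (h1 : ∑ c, m c = 1)
    {u : S → ι → ℝ} (hu : ∀ c, Measurable fun t => u t c) {B : ℝ}
    (hB : ∀ t c, u t c ∈ Set.Icc 0 B) :
    ∃ p, ∀ p', pricePotential μ m u p ≤ pricePotential μ m u p' := by
  have hm0 : ∀ c, 0 ≤ m c := fun c => (hm c).le
  have hint := fun p => integrable_log_softmaxSum (μ := μ) hm0 h1 hu hB p
  have hcont : Continuous (pricePotential μ m u) := by
    have : LipschitzWith 1 fun p : ι → ℝ => ∫ t, Real.log (softmaxSum m (u t) p) ∂μ := by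
      refine LipschitzWith.of_le_add fun p p' => ?_
      have : ∫ t, Real.log (softmaxSum m (u t) p) ∂μ
          ≤ ∫ t, (dist p p' + Real.log (softmaxSum m (u t) p')) ∂μ := by
        refine integral_mono (hint p) ((integrable_const _).add (hint p')) fun t => ?_
        refine log_softmaxSum_le_add hm0 h1 fun c => ?_
        have := dist_le_pi_dist p p' c
        rw [Real.dist_eq] at this
        linarith [(abs_le.1 this).1]
      rw [integral_add (integrable_const _) (hint p')] at this
      simp at this
      linarith
    unfold pricePotential
    have h2 := this.continuous
    fun_prop
  -- lower bounds on the potential that make its sublevel set at the value in `0` bounded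
  have hlow1 : ∀ p, (∑ c, m c * p c) ^ 2 ≤ pricePotential μ m u p := by
    intro p
    have : ∫ _t, -(∑ c, m c * p c) ∂μ ≤ ∫ t, Real.log (softmaxSum m (u t) p) ∂μ := by
      refine integral_mono (integrable_const _) (hint p) fun t => ?_
      refine le_trans ?_ (sum_le_log_softmaxSum hm0 h1 _ _)
      rw [← Finset.sum_neg_distrib]
      refine Finset.sum_le_sum fun c _ => ?_
      have := mul_nonneg (hm0 c) (hB t c).1
      linarith
    simp at this
    unfold pricePotential
    linarith
  have hlow2 : ∀ p c, Real.log (m c) - p c + ∑ c, m c * p c ≤ pricePotential μ m u p := by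
    intro p c
    have : ∫ _t, (Real.log (m c) - p c) ∂μ ≤ ∫ t, Real.log (softmaxSum m (u t) p) ∂μ := by
      refine integral_mono (integrable_const _) (hint p) fun t => ?_
      refine le_trans ?_ (log_add_le_log_softmaxSum hm0 _ _ (hm c))
      linarith [(hB t c).1]
    simp at this
    unfold pricePotential
    nlinarith [sq_nonneg (∑ c, m c * p c)]
  set F := pricePotential μ m u with hF
  have hF0 : 0 ≤ F 0 := by simpa using hlow1 0
  set R : ℝ := 2 * F 0 + 1 + ∑ c, |Real.log (m c)| with hR
  have hR0 : 0 ≤ R := by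
    have : 0 ≤ ∑ c, |Real.log (m c)| := Finset.sum_nonneg fun c _ => abs_nonneg _
    rw [hR]; linarith
  set K : Set (ι → ℝ) := Set.Icc (fun _ => -R) (fun c => 2 * R / m c) with hK
  have hbd : ∀ p, F p ≤ F 0 → p ∈ K := by
    intro p hp
    have hs := hlow1 p
    set σ := ∑ c, m c * p c with hσ
    have hσ1 : |σ| ≤ F 0 + 1 := by
      rw [abs_le]; constructor <;> nlinarith
    have hlo : ∀ c, -R ≤ p c := by
      intro c
      have h2 := hlow2 p c
      have h3 : |Real.log (m c)| ≤ ∑ c, |Real.log (m c)| :=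
        Finset.single_le_sum (f := fun c => |Real.log (m c)|) (fun c _ => abs_nonneg _)
          (Finset.mem_univ c)
      have h4 := neg_abs_le (Real.log (m c))
      have h5 := (abs_le.1 hσ1).1
      rw [hR]; linarith
    refine ⟨hlo, fun c => ?_⟩
    have h2 : m c * (p c + R) ≤ ∑ c, m c * (p c + R) :=
      Finset.single_le_sum (f := fun c => m c * (p c + R))
        (fun c _ => mul_nonneg (hm0 c) (by linarith [hlo c])) (Finset.mem_univ c)
    have h3 : ∑ c, m c * (p c + R) = σ + R := by
      simp only [mul_add, Finset.sum_add_distrib, ← Finset.sum_mul, h1, one_mul, hσ]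
    rw [le_div_iff₀ (hm c)]
    have h4 := (abs_le.1 hσ1).2
    have h5 : 0 ≤ ∑ c, |Real.log (m c)| := Finset.sum_nonneg fun c _ => abs_nonneg _
    nlinarith [mul_nonneg (hm0 c) hR0]
  have h0K : (0 : ι → ℝ) ∈ K := hbd 0 le_rfl
  obtain ⟨p, hpK, hp⟩ := isCompact_Icc.exists_isMinOn (s := K) ⟨0, h0K⟩ hcont.continuousOn
  refine ⟨p, fun p' => ?_⟩
  by_cases h : F p' ≤ F 0
  · exact hp (hbd p' h)
  · exact (hp h0K).trans (not_le.1 h).le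

/-- Raising the price of one option by `x` changes the log-partition function by at most the first
order effect. -/
lemma log_softmaxSum_update_le [DecidableEq ι] {m : ι → ℝ} (hm : ∀ c, 0 ≤ m c)
    (h1 : ∑ c, m c = 1) (u p : ι → ℝ) (c : ι) (x : ℝ) :
    Real.log (softmaxSum m u (p + Pi.single c x)) ≤ Real.log (softmaxSum m u p) +
      m c * (Real.exp (u c - p c) / softmaxSum m u p) * (Real.exp (-x) - 1) := by
  have hZ := softmaxSum_pos hm h1 u p
  have hZ' := softmaxSum_pos hm h1 u (p + Pi.single c x)
  have key : softmaxSum m u (p + Pi.single c x)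
      = softmaxSum m u p + m c * Real.exp (u c - p c) * (Real.exp (-x) - 1) := by
    unfold softmaxSum
    rw [← Finset.add_sum_erase _ _ (Finset.mem_univ c),
      ← Finset.add_sum_erase (a := c) _ (fun c => m c * Real.exp (u c - p c)) (Finset.mem_univ c)]
    have : ∑ d ∈ Finset.univ.erase c, m d * Real.exp (u d - (p + Pi.single c x : ι → ℝ) d)
        = ∑ d ∈ Finset.univ.erase c, m d * Real.exp (u d - p d) := by
      refine Finset.sum_congr rfl fun d hd => ?_
      simp [Finset.ne_of_mem_erase hd]
    rw [this]
    have : u c - (p + Pi.single c x : ι → ℝ) c = (u c - p c) + -x := by simp; ring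
    rw [this, Real.exp_add]
    ring
  have h2 := Real.log_le_sub_one_of_pos (div_pos hZ' hZ)
  rw [Real.log_div hZ'.ne' hZ.ne'] at h2
  have h3 : softmaxSum m u (p + Pi.single c x) / softmaxSum m u p - 1
      = m c * (Real.exp (u c - p c) / softmaxSum m u p) * (Real.exp (-x) - 1) := by
    rw [key]; field_simp; ring
  linarith

lemma sum_mul_softmax {m : ι → ℝ} (hm : ∀ c, 0 ≤ m c) (h1 : ∑ c, m c = 1) (u p : ι → ℝ) :
    ∑ c, m c * (Real.exp (u c - p c) / softmaxSum m u p) = 1 := by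
  have hZ := softmaxSum_pos hm h1 u p
  simp_rw [← mul_div_assoc]
  rw [← Finset.sum_div]
  exact div_self hZ.ne'

lemma softmax_le_exp {m : ι → ℝ} (hm : ∀ c, 0 ≤ m c) (h1 : ∑ c, m c = 1) {u p : ι → ℝ}
    {b : ℝ} (hb : ∀ c, |u c - p c| ≤ b) (c : ι) :
    Real.exp (u c - p c) / softmaxSum m u p ≤ Real.exp (2 * b) := by
  have hZ := softmaxSum_pos hm h1 u p
  rw [div_le_iff₀ hZ]
  have h2 := abs_log_softmaxSum_le hm h1 hb
  have h3 : softmaxSum m u p = Real.exp (Real.log (softmaxSum m u p)) := (Real.exp_log hZ).symm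
  rw [h3, ← Real.exp_add, Real.exp_le_exp]
  linarith [(abs_le.1 (hb c)).2, (abs_le.1 h2).1]

lemma measurable_softmax {u : S → ι → ℝ} (hu : ∀ c, Measurable fun t => u t c)
    (m p : ι → ℝ) (c : ι) :
    Measurable fun t => Real.exp (u t c - p c) / softmaxSum m (u t) p :=
  ((hu c).sub_const _).exp.div (measurable_softmaxSum hu m p)

lemma integrable_softmax {m : ι → ℝ} (hm : ∀ c, 0 ≤ m c) (h1 : ∑ c, m c = 1)
    {u : S → ι → ℝ} (hu : ∀ c, Measurable fun t => u t c) {B : ℝ}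
    (hB : ∀ t c, u t c ∈ Set.Icc 0 B) (p : ι → ℝ) (c : ι) :
    Integrable (fun t => Real.exp (u t c - p c) / softmaxSum m (u t) p) μ := by
  refine integrable_of_measurable_of_abs_le (measurable_softmax hu m p c)
    (C := Real.exp (2 * (B + ∑ c, |p c|))) fun t => ?_
  rw [abs_of_nonneg (div_nonneg (Real.exp_pos _).le (softmaxSum_pos hm h1 _ _).le)]
  refine softmax_le_exp hm h1 (fun c => ?_) c
  have h2 : |p c| ≤ ∑ c, |p c| :=
    Finset.single_le_sum (f := fun c => |p c|) (fun c _ => abs_nonneg _) (Finset.mem_univ c)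
  have h3 := hB t c
  calc |u t c - p c| ≤ |u t c| + |p c| := abs_sub _ _
    _ ≤ _ := by rw [abs_of_nonneg h3.1]; linarith [h3.2]

/-- Market clearing prices for softmax demand, all options having positive supply. -/
lemma exists_clearing_prices_of_pos {m : ι → ℝ} (hm : ∀ c, 0 < m c) (h1 : ∑ c, m c = 1)
    {u : S → ι → ℝ} (hu : ∀ c, Measurable fun t => u t c) {B : ℝ}
    (hB : ∀ t c, u t c ∈ Set.Icc 0 B) :
    ∃ p : ι → ℝ, ∑ c, m c * p c = 0 ∧
      ∀ c, ∫ t, Real.exp (u t c - p c) / softmaxSum m (u t) p ∂μ = 1 := by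
  classical
  have hm0 : ∀ c, 0 ≤ m c := fun c => (hm c).le
  obtain ⟨p, hp⟩ := exists_min_pricePotential (μ := μ) hm h1 hu hB
  have hint := fun p => integrable_log_softmaxSum (μ := μ) hm0 h1 hu hB p
  have hint2 := fun c => integrable_softmax (μ := μ) hm0 h1 hu hB p c
  set σ := ∑ c, m c * p c with hσ
  set A : ι → ℝ := fun c => ∫ t, Real.exp (u t c - p c) / softmaxSum m (u t) p ∂μ with hA
  -- first order condition for the price of `c`; along this direction the potential lies below the
  -- differentiable function `φ` and agrees with it at `0`, up to a constant
  have hfoc : ∀ c, -(m c * A c) + m c + 2 * σ * m c = 0 := by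
    intro c
    let φ : ℝ → ℝ := fun x =>
      m c * A c * (Real.exp (-x) - 1) + (σ + m c * x) + (σ + m c * x) ^ 2
    have hφ : ∀ x, φ 0 ≤ φ x := by
      intro x
      have h2 := hp (p + Pi.single c x)
      have h3 : ∑ d, m d * (p + Pi.single c x : ι → ℝ) d = σ + m c * x := by
        simp [mul_add, Finset.sum_add_distrib, hσ, Pi.single_apply]
      have h4 : ∫ t, Real.log (softmaxSum m (u t) (p + Pi.single c x)) ∂μ ≤
          ∫ t, (Real.log (softmaxSum m (u t) p) +
            m c * (Real.exp (u t c - p c) / softmaxSum m (u t) p) * (Real.exp (-x) - 1)) ∂μ :=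
        integral_mono (hint _) ((hint _).add (((hint2 c).const_mul _).mul_const _))
          fun t => log_softmaxSum_update_le hm0 h1 (u t) p c x
      rw [integral_add (hint _) (((hint2 c).const_mul _).mul_const _), integral_mul_const,
        integral_const_mul] at h4
      unfold pricePotential at h2
      rw [h3, ← hσ] at h2
      simp only [φ, hA]
      simp
      linarith
    have hd : HasDerivAt φ (m c * A c * (Real.exp (-0) * (-1)) + (m c * 1) +
        2 * (σ + m c * 0) ^ (2 - 1) * (m c * 1)) 0 := by
      have e1 : HasDerivAt (fun x : ℝ => σ + m c * x) (m c * 1) 0 :=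
        ((hasDerivAt_id (0 : ℝ)).const_mul (m c)).const_add σ
      have e2 : HasDerivAt (fun x : ℝ => Real.exp (-x) - 1) (Real.exp (-0) * (-1)) 0 :=
        ((hasDerivAt_neg (0 : ℝ)).exp).sub_const 1
      have e3 := e1.pow 2
      exact ((e2.const_mul (m c * A c)).add e1).add e3
    have := IsLocalMin.hasDerivAt_eq_zero (Filter.Eventually.of_forall hφ) hd
    simp at this
    linarith
  have hsumA : ∑ c, m c * A c = 1 := by
    have : ∑ c, m c * A c
        = ∫ t, ∑ c, m c * (Real.exp (u t c - p c) / softmaxSum m (u t) p) ∂μ := by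
      rw [integral_finsetSum _ fun c _ => (hint2 c).const_mul _]
      simp [hA, integral_const_mul]
    rw [this]
    simp [sum_mul_softmax hm0 h1]
  -- summing the first order conditions yields the normalization
  have hσ0 : σ = 0 := by
    have := Finset.sum_congr (rfl : (Finset.univ : Finset ι) = _) fun c _ => hfoc c
    simp only [Finset.sum_add_distrib, Finset.sum_neg_distrib, ← Finset.mul_sum, h1, hsumA] at this
    simp at this
    exact this
  refine ⟨p, hσ0, fun c => ?_⟩
  have := hfoc c
  rw [hσ0] at this
  have h2 : m c * A c = m c * 1 := by linarith
  exact mul_left_cancel₀ (hm c).ne' h2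

/-- **Market clearing prices for softmax demand.** There are prices, of mean zero and no larger than
the range of the utilities, at which the softmax demand for every option equals its supply `m c`
(the demand being `m c` times the integral below). -/
theorem exists_clearing_prices {m : ι → ℝ} (hm : ∀ c, 0 ≤ m c) (h1 : ∑ c, m c = 1)
    {u : S → ι → ℝ} (hu : ∀ c, Measurable fun t => u t c) {B : ℝ}
    (hB : ∀ t c, u t c ∈ Set.Icc 0 B) :
    ∃ p : ι → ℝ, ∑ c, m c * p c = 0 ∧ (∀ c, |p c| ≤ B) ∧
      ∀ c, m c ≠ 0 → ∫ t, Real.exp (u t c - p c) / softmaxSum m (u t) p ∂μ = 1 := by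
  classical
  have hsub : ∀ f : ι → ℝ, ∑ c : {c // m c ≠ 0}, m c * f c = ∑ c, m c * f c := by
    intro f
    rw [← Finset.sum_subtype (Finset.univ.filter fun c => m c ≠ 0) (by simp)
      (fun c => m c * f c)]
    exact Finset.sum_filter_of_ne fun c _ h => left_ne_zero_of_mul h
  obtain ⟨p', hp0, hp⟩ := exists_clearing_prices_of_pos (μ := μ)
    (m := fun c : {c // m c ≠ 0} => m c) (u := fun t c => u t c) (B := B)
    (fun c => lt_of_le_of_ne (hm c) c.2.symm)
    (by have := hsub 1; simp only [Pi.one_apply, mul_one] at this; rw [this, h1])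
    (fun c => hu c) (fun t c => hB t c)
  let p : ι → ℝ := fun c => if h : m c ≠ 0 then p' ⟨c, h⟩ else 0
  have hpp : ∀ c : {c // m c ≠ 0}, p c = p' c := fun c => by simp only [p, dif_pos c.2]
  have hZ : ∀ t, softmaxSum (fun c : {c // m c ≠ 0} => m c) (fun c => u t c) p'
      = softmaxSum m (u t) p := by
    intro t
    unfold softmaxSum
    rw [← hsub fun c => Real.exp (u t c - p c)]
    simp only [hpp]
  have hclear : ∀ c, m c ≠ 0 →
      ∫ t, Real.exp (u t c - p c) / softmaxSum m (u t) p ∂μ = 1 := by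
    intro c hc
    have := hp ⟨c, hc⟩
    simp only [hZ, ← hpp] at this
    exact this
  have hmean : ∑ c, m c * p c = 0 := by
    have := hsub p
    simp only [hpp] at this
    rw [← this, hp0]
  have hint := fun c => integrable_softmax (μ := μ) hm h1 hu hB p c
  -- if two prices differed by more than `B`, one demand would exceed the other pointwise
  have hspread : ∀ c d, m c ≠ 0 → m d ≠ 0 → p d - p c ≤ B := by
    intro c d hc hd
    have h2 : ∫ t, Real.exp (p d - p c - B) * (Real.exp (u t d - p d) / softmaxSum m (u t) p) ∂μ
        ≤ ∫ t, Real.exp (u t c - p c) / softmaxSum m (u t) p ∂μ := by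
      refine integral_mono ((hint d).const_mul _) (hint c) fun t => ?_
      simp only [← mul_div_assoc, ← Real.exp_add]
      refine div_le_div_of_nonneg_right (Real.exp_le_exp.2 ?_) (softmaxSum_pos hm h1 _ _).le
      linarith [(hB t d).2, (hB t c).1]
    rw [integral_const_mul, hclear c hc, hclear d hd, mul_one, Real.exp_le_one_iff] at h2
    linarith
  have hB0 : 0 ≤ B := by
    obtain ⟨t⟩ : Nonempty S := nonempty_of_isProbabilityMeasure μ
    obtain ⟨c, -⟩ : (Finset.univ : Finset ι).Nonempty := by
      by_contra h
      rw [Finset.not_nonempty_iff_eq_empty.1 h] at h1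
      simp at h1
    exact (hB t c).1.trans (hB t c).2
  refine ⟨p, hmean, fun c => ?_, hclear⟩
  by_cases hc : m c ≠ 0
  · have hup : ∑ d, m d * p c ≤ ∑ d, m d * (p d + B) := Finset.sum_le_sum fun d _ => by
      rcases eq_or_ne (m d) 0 with hd | hd
      · simp [hd]
      · exact mul_le_mul_of_nonneg_left (by linarith [hspread d c hd hc]) (hm d)
    have hlo : ∑ d, m d * (p d - B) ≤ ∑ d, m d * p c := Finset.sum_le_sum fun d _ => by
      rcases eq_or_ne (m d) 0 with hd | hd
      · simp [hd]
      · exact mul_le_mul_of_nonneg_left (by linarith [hspread c d hc hd]) (hm d)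
    simp only [mul_add, mul_sub, Finset.sum_add_distrib, Finset.sum_sub_distrib, ← Finset.sum_mul,
      h1, hmean, one_mul] at hup hlo
    rw [abs_le]; constructor <;> linarith
  · rw [show p c = 0 from dif_neg hc, abs_zero]
    exact hB0

end Prices

/-! ### Measure preserving assignments with exact incentives -/

section Assignment

variable {S : Type*} [MeasurableSpace S] {ι : Type*} [Fintype ι] [MeasurableSpace ι]
  [MeasurableSingletonClass ι]

lemma integral_comp_mul_eq_sum {μ : Measure S} {c : S → ι} (hc : Measurable c) (a : ι → ℝ)
    {f : S → ℝ} (hf : Integrable f μ) :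
    ∫ s, a (c s) * f s ∂μ = ∑ i, a i * ∫ s in c ⁻¹' {i}, f s ∂μ := by
  classical
  have h : ∀ s, a (c s) * f s = ∑ i, (c ⁻¹' {i}).indicator (fun s => a i * f s) s := by
    intro s
    simp [Set.indicator_apply]
  have hm : ∀ i, MeasurableSet (c ⁻¹' {i}) := fun i => hc (measurableSet_singleton i)
  simp_rw [h]
  rw [integral_finsetSum _ fun i _ => (hf.const_mul _).indicator (hm i)]
  refine Finset.sum_congr rfl fun i _ => ?_
  rw [integral_indicator (hm i), integral_const_mul]

lemma integral_comp_eq_sum {μ : Measure S} [IsFiniteMeasure μ] {c : S → ι} (hc : Measurable c)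
    (a : ι → ℝ) : ∫ s, a (c s) ∂μ = ∑ i, μ.real (c ⁻¹' {i}) * a i := by
  have := integral_comp_mul_eq_sum (μ := μ) hc a (f := fun _ => (1 : ℝ)) (integrable_const _)
  simpa [mul_comm] using this

omit [MeasurableSpace ι] [MeasurableSingletonClass ι] in
lemma ae_measureReal_cell_ne_zero {μ : Measure S} [IsFiniteMeasure μ] (c : S → ι) :
    ∀ᵐ s ∂μ, μ.real (c ⁻¹' {c s}) ≠ 0 := by
  have h2 : ∀ᵐ s ∂μ, ∀ i, μ.real (c ⁻¹' {i}) = 0 → c s ≠ i := by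
    rw [ae_all_iff]
    intro i
    by_cases hi : μ.real (c ⁻¹' {i}) = 0
    · have : μ (c ⁻¹' {i}) = 0 := by simpa [measureReal_eq_zero_iff] using hi
      filter_upwards [measure_eq_zero_iff_ae_notMem.1 this] with s hs _ using hs
    · exact Filter.Eventually.of_forall fun s h => absurd h hi
  filter_upwards [h2] with s hs h using hs _ h rfl

/-- The average of `h t` over the `i`-th cell of the partition `c` (zero if the cell is null). -/
noncomputable def cellAverage (μ : Measure S) (c : S → ι) (h : S → S → ℝ) (t : S) (i : ι) : ℝ :=
  (∫ s in c ⁻¹' {i}, h t s ∂μ) / μ.real (c ⁻¹' {i})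

omit [Fintype ι] [MeasurableSpace ι] [MeasurableSingletonClass ι] in
lemma measurable_cellAverage {μ : Measure S} [SFinite μ] (c : S → ι) {h : S → S → ℝ}
    (hm : Measurable fun z : S × S => h z.1 z.2) (i : ι) :
    Measurable fun t => cellAverage μ c h t i :=
  (hm.stronglyMeasurable.integral_prod_right (ν := μ.restrict (c ⁻¹' {i}))).measurable.div_const _

omit [Fintype ι] [MeasurableSpace ι] [MeasurableSingletonClass ι] in
lemma measureReal_mul_cellAverage {μ : Measure S} [IsFiniteMeasure μ] (c : S → ι) (h : S → S → ℝ)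
    (t : S) (i : ι) :
    μ.real (c ⁻¹' {i}) * cellAverage μ c h t i = ∫ s in c ⁻¹' {i}, h t s ∂μ := by
  unfold cellAverage
  rcases eq_or_ne (μ.real (c ⁻¹' {i})) 0 with h0 | h0
  · have : μ (c ⁻¹' {i}) = 0 := by simpa [measureReal_eq_zero_iff] using h0
    rw [h0, zero_mul, Measure.restrict_eq_zero.2 this, integral_zero_measure]
  · field_simp

omit [Fintype ι] [MeasurableSpace ι] [MeasurableSingletonClass ι] in
lemma cellAverage_mem_Icc {μ : Measure S} [IsFiniteMeasure μ] (c : S → ι) {h : S → S → ℝ}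
    (hm : Measurable fun z : S × S => h z.1 z.2) {B : ℝ} (hB : ∀ t s, h t s ∈ Set.Icc 0 B)
    (t : S) (i : ι) : cellAverage μ c h t i ∈ Set.Icc 0 B := by
  have hB0 : 0 ≤ B := (hB t t).1.trans (hB t t).2
  refine ⟨div_nonneg (integral_nonneg fun s => (hB t s).1) measureReal_nonneg, ?_⟩
  refine div_le_of_le_mul₀ measureReal_nonneg hB0 ?_
  have hint : Integrable (h t) μ :=
    integrable_of_measurable_of_abs_le (hm.comp measurable_prodMk_left) (C := B) fun s => by
      rw [abs_of_nonneg (hB t s).1]; exact (hB t s).2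
  calc ∫ s in c ⁻¹' {i}, h t s ∂μ ≤ ∫ _s in c ⁻¹' {i}, B ∂μ :=
        integral_mono hint.integrableOn (integrable_const _) fun s => (hB t s).2
    _ = B * μ.real (c ⁻¹' {i}) := by simp [mul_comm]

omit [MeasurableSpace ι] [MeasurableSingletonClass ι] in
/-- The log-partition function lies above its tangents. -/
lemma sum_softmax_mul_sub_le {m : ι → ℝ} (hm : ∀ c, 0 ≤ m c) (h1 : ∑ c, m c = 1)
    (u u' p : ι → ℝ) :
    ∑ i, m i * (Real.exp (u' i - p i) / softmaxSum m u' p) * (u i - u' i)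
      ≤ Real.log (softmaxSum m u p) - Real.log (softmaxSum m u' p) := by
  have hZ := softmaxSum_pos hm h1 u p
  have hZ' := softmaxSum_pos hm h1 u' p
  have h2 := sum_le_log_softmaxSum
    (m := fun i => m i * (Real.exp (u' i - p i) / softmaxSum m u' p))
    (fun i => mul_nonneg (hm i) (div_pos (Real.exp_pos _) hZ').le) (sum_mul_softmax hm h1 u' p) u u'
  have h3 : softmaxSum (fun i => m i * (Real.exp (u' i - p i) / softmaxSum m u' p)) u u'
      = softmaxSum m u p / softmaxSum m u' p := by
    conv_rhs => rw [softmaxSum, Finset.sum_div]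
    conv_lhs => rw [softmaxSum]
    refine Finset.sum_congr rfl fun i _ => ?_
    rw [show u i - p i = (u' i - p i) + (u i - u' i) by ring, Real.exp_add]
    ring
  rwa [h3, Real.log_div hZ.ne' hZ'.ne'] at h2

omit [MeasurableSpace ι] [MeasurableSingletonClass ι] in
/-- The relative entropy of the softmax lottery with respect to `m` is nonnegative. -/
lemma sum_softmax_mul_price_le {m : ι → ℝ} (hm : ∀ c, 0 ≤ m c) (h1 : ∑ c, m c = 1)
    (u p : ι → ℝ) :
    ∑ i, m i * (Real.exp (u i - p i) / softmaxSum m u p) * p i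
      ≤ ∑ i, m i * (Real.exp (u i - p i) / softmaxSum m u p) * u i
        - Real.log (softmaxSum m u p) := by
  have hZ := softmaxSum_pos hm h1 u p
  have hρ1 := sum_mul_softmax hm h1 u p
  have hlog : ∀ i, Real.log (Real.exp (u i - p i) / softmaxSum m u p)
      = u i - p i - Real.log (softmaxSum m u p) := fun i => by
    rw [Real.log_div (Real.exp_pos _).ne' hZ.ne', Real.log_exp]
  have hρ0 : ∀ i, 0 < Real.exp (u i - p i) / softmaxSum m u p := fun i =>
    div_pos (Real.exp_pos _) hZ
  generalize hρ : (fun i => Real.exp (u i - p i) / softmaxSum m u p) = ρ at *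
  have hρ' : ∀ i, Real.exp (u i - p i) / softmaxSum m u p = ρ i := fun i => congrFun hρ i
  simp only [hρ'] at *
  have h2 : 0 ≤ ∑ i, m i * ρ i * Real.log (ρ i) := by
    calc (0 : ℝ) = ∑ i, m i * (ρ i - 1) := by
          simp [mul_sub, Finset.sum_sub_distrib, hρ1, h1]
      _ ≤ _ := Finset.sum_le_sum fun i _ => by
          rw [mul_assoc]
          refine mul_le_mul_of_nonneg_left ?_ (hm i)
          have := Real.one_sub_inv_le_log_of_pos (hρ0 i)
          have h2 := mul_le_mul_of_nonneg_left this (hρ0 i).le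
          rwa [mul_sub, mul_one, mul_inv_cancel₀ (hρ0 i).ne'] at h2
  simp only [hlog, mul_sub, Finset.sum_sub_distrib, ← Finset.sum_mul, hρ1, one_mul] at h2
  linarith

omit [MeasurableSpace ι] [MeasurableSingletonClass ι] in
lemma neg_card_le_sum_mul_log {m : ι → ℝ} (hm : ∀ c, 0 ≤ m c) :
    -(Fintype.card ι : ℝ) ≤ ∑ i, m i * Real.log (m i) := by
  calc -(Fintype.card ι : ℝ) = ∑ _i : ι, (-1 : ℝ) := by simp
    _ ≤ _ := Finset.sum_le_sum fun i _ => by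
        rcases eq_or_lt_of_le (hm i) with h0 | h0
        · rw [← h0]; simp
        · have := mul_le_mul_of_nonneg_left (Real.one_sub_inv_le_log_of_pos h0) h0.le
          rw [mul_sub, mul_one, mul_inv_cancel₀ h0.ne'] at this
          linarith

/-- A randomized, measure preserving reassignment of types: `density t` is the density, with respect
to the type distribution `μ`, of the type reported in place of `t`, and both marginals are `μ`. -/
structure TypeRemap (μ : Measure S) where
  density : S → S → ℝ
  measurable_density : Measurable fun z : S × S => density z.1 z.2
  density_nonneg : ∀ t s, 0 ≤ density t s
  bound : ℝ
  density_le : ∀ t s, density t s ≤ bound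
  integral_right : ∀ t, ∫ s, density t s ∂μ = 1
  integral_left : ∀ᵐ s ∂μ, ∫ t, density t s ∂μ = 1

variable {μ : Measure S} [IsProbabilityMeasure μ]

/-- Every type is sent to a cell by softmax demand at clearing prices, then to a random type of that
cell. -/
noncomputable def TypeRemap.ofSoftmax {c : S → ι} (hc : Measurable c) {u : S → ι → ℝ}
    (hu : ∀ i, Measurable fun t => u t i) {b : ℝ} (p : ι → ℝ) (hb : ∀ t i, |u t i - p i| ≤ b)
    (hp : ∀ i, μ.real (c ⁻¹' {i}) ≠ 0 →
      ∫ t, Real.exp (u t i - p i) / softmaxSum (fun i => μ.real (c ⁻¹' {i})) (u t) p ∂μ = 1) :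
    TypeRemap μ :=
  have hm0 : ∀ i, 0 ≤ μ.real (c ⁻¹' {i}) := fun i => measureReal_nonneg
  have hm1 : ∑ i, μ.real (c ⁻¹' {i}) = 1 := by
    have := integral_comp_eq_sum (μ := μ) hc fun _ => (1 : ℝ)
    simpa using this.symm
  { density := fun t s =>
      Real.exp (u t (c s) - p (c s)) / softmaxSum (fun i => μ.real (c ⁻¹' {i})) (u t) p
    measurable_density :=
      (measurable_from_prod_countable_left (f := fun z : S × ι =>
        Real.exp (u z.1 z.2 - p z.2) / softmaxSum (fun i => μ.real (c ⁻¹' {i})) (u z.1) p)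
        fun i => measurable_softmax hu _ p i).comp
        (measurable_fst.prodMk (hc.comp measurable_snd))
    density_nonneg := fun t s =>
      div_nonneg (Real.exp_pos _).le (softmaxSum_pos hm0 hm1 _ _).le
    bound := Real.exp (2 * b)
    density_le := fun t s => softmax_le_exp hm0 hm1 (hb t) _
    integral_right := fun t => by
      rw [integral_comp_eq_sum hc fun i =>
        Real.exp (u t i - p i) / softmaxSum (fun i => μ.real (c ⁻¹' {i})) (u t) p]
      exact sum_mul_softmax hm0 hm1 (u t) p
    integral_left := by
      filter_upwards [ae_measureReal_cell_ne_zero (μ := μ) c] with s hs using hp _ hs }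

/-- The case of unit temperature of `exists_typeRemap_of_cells`. -/
lemma exists_typeRemap_of_cells_aux {c : S → ι} (hc : Measurable c) {B : ℝ} {h : S → S → ℝ}
    (hm : Measurable fun z : S × S => h z.1 z.2) (hB : ∀ t s, h t s ∈ Set.Icc 0 B) :
    ∃ (R : TypeRemap μ) (pr : S → ℝ), Measurable pr ∧
      (∀ t w, ∫ s, R.density w s * h t s ∂μ - pr w ≤ ∫ s, R.density t s * h t s ∂μ - pr t) ∧
      (∀ t, pr t ≤ ∫ s, R.density t s * h t s ∂μ) ∧ (∀ t, -B ≤ pr t) ∧ 0 ≤ ∫ t, pr t ∂μ ∧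
      ∫ t, cellAverage μ c h t (c t) ∂μ - Fintype.card ι
        ≤ ∫ t, ∫ s, R.density t s * h t s ∂μ ∂μ := by
  have hhint : ∀ t, Integrable (h t) μ := fun t =>
    integrable_of_measurable_of_abs_le (hm.comp measurable_prodMk_left) (C := B) fun s => by
      rw [abs_of_nonneg (hB t s).1]; exact (hB t s).2
  have hum : ∀ i, Measurable fun t => cellAverage μ c h t i := measurable_cellAverage c hm
  have huB : ∀ t i, cellAverage μ c h t i ∈ Set.Icc 0 B := cellAverage_mem_Icc c hm hB
  have hmu := measureReal_mul_cellAverage (μ := μ) c h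
  generalize cellAverage μ c h = u at *
  have hm0 : ∀ i, 0 ≤ μ.real (c ⁻¹' {i}) := fun i => measureReal_nonneg
  have hm1 : ∑ i, μ.real (c ⁻¹' {i}) = 1 := by
    have := integral_comp_eq_sum (μ := μ) hc fun _ => (1 : ℝ)
    simpa using this.symm
  obtain ⟨p, hp0, hpB, hp⟩ := exists_clearing_prices (μ := μ) hm0 hm1 hum huB
  have hup : ∀ t i, |u t i - p i| ≤ 2 * B := by
    intro t i
    have h1 := huB t i
    have h2 := abs_le.1 (hpB i)
    rw [abs_le]; constructor <;> linarith [h1.1, h1.2, h2.1, h2.2]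
  -- the facts about the softmax lottery `ρ` and the log-partition function `L` that are used;
  -- the transfer is the utility from the lottery minus `L`, that is, its price plus its relative
  -- entropy
  obtain ⟨R, ρ, L, hR, hρm, hρint, hρ0, hρ1, hρclear, hLm, hLint, htan, hent, hjen, hlow⟩ :
      ∃ (R : TypeRemap μ) (ρ : S → ι → ℝ) (L : S → ℝ),
        (∀ t s, R.density t s = ρ t (c s)) ∧ (∀ i, Measurable fun t => ρ t i) ∧
        (∀ i, Integrable (fun t => ρ t i) μ) ∧ (∀ t i, 0 ≤ ρ t i) ∧
        (∀ t, ∑ i, μ.real (c ⁻¹' {i}) * ρ t i = 1) ∧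
        (∀ i, μ.real (c ⁻¹' {i}) ≠ 0 → ∫ t, ρ t i ∂μ = 1) ∧ Measurable L ∧ Integrable L μ ∧
        (∀ t t', ∑ i, μ.real (c ⁻¹' {i}) * ρ t' i * (u t i - u t' i) ≤ L t - L t') ∧
        (∀ t, ∑ i, μ.real (c ⁻¹' {i}) * ρ t i * p i
          ≤ ∑ i, μ.real (c ⁻¹' {i}) * ρ t i * u t i - L t) ∧
        (∀ t, ∑ i, μ.real (c ⁻¹' {i}) * (u t i - p i) ≤ L t) ∧
        (∀ t i, 0 < μ.real (c ⁻¹' {i}) → Real.log (μ.real (c ⁻¹' {i})) + (u t i - p i) ≤ L t) :=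
    ⟨TypeRemap.ofSoftmax (μ := μ) hc hum p hup hp, _, _, fun t s => rfl,
      fun i => measurable_softmax hum (fun i => μ.real (c ⁻¹' {i})) p i,
      fun i => integrable_softmax (μ := μ) hm0 hm1 hum huB p i,
      fun t i => div_nonneg (Real.exp_pos _).le (softmaxSum_pos hm0 hm1 (u t) p).le,
      fun t => sum_mul_softmax hm0 hm1 (u t) p, hp,
      (measurable_softmaxSum hum (fun i => μ.real (c ⁻¹' {i})) p).log,
      integrable_log_softmaxSum (μ := μ) hm0 hm1 hum huB p,
      fun t t' => sum_softmax_mul_sub_le hm0 hm1 (u t) (u t') p,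
      fun t => sum_softmax_mul_price_le hm0 hm1 (u t) p,
      fun t => sum_le_log_softmaxSum hm0 hm1 (u t) p,
      fun t i => log_add_le_log_softmaxSum hm0 (u t) p (c := i)⟩
  have hae := ae_measureReal_cell_ne_zero (μ := μ) c
  have hRh : ∀ t t', ∫ s, R.density t s * h t' s ∂μ
      = ∑ i, μ.real (c ⁻¹' {i}) * ρ t i * u t' i := by
    intro t t'
    simp only [hR]
    rw [integral_comp_mul_eq_sum hc (ρ t) (hhint t')]
    refine Finset.sum_congr rfl fun i _ => ?_
    rw [← hmu]; ring
  have hcavg := fun a : ι → ℝ => integral_comp_eq_sum (μ := μ) hc a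
  obtain ⟨m, hmdef⟩ : ∃ m : ι → ℝ, ∀ i, μ.real (c ⁻¹' {i}) = m i := ⟨_, fun i => rfl⟩
  simp only [hmdef] at hm0 hm1 hp0 hρ1 hρclear htan hent hjen hlow hae hRh hcavg
  have hSm : Measurable fun t => ∑ i, m i * ρ t i * u t i :=
    Finset.measurable_fun_sum _ fun i _ => ((hρm i).const_mul _).mul (hum i)
  have hSint : Integrable (fun t => ∑ i, m i * ρ t i * u t i) μ := by
    refine integrable_of_measurable_of_abs_le hSm (C := B) fun t => ?_
    rw [abs_of_nonneg (Finset.sum_nonneg fun i _ =>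
      mul_nonneg (mul_nonneg (hm0 i) (hρ0 t i)) (huB t i).1)]
    calc ∑ i, m i * ρ t i * u t i ≤ ∑ i, m i * ρ t i * B := Finset.sum_le_sum fun i _ =>
          mul_le_mul_of_nonneg_left (huB t i).2 (mul_nonneg (hm0 i) (hρ0 t i))
      _ = B := by rw [← Finset.sum_mul, hρ1, one_mul]
  have hprmean : 0 ≤ ∫ t, (∑ i, m i * ρ t i * u t i - L t) ∂μ := by
    have h1 : ∫ t, ∑ i, m i * ρ t i * p i ∂μ = 0 := by
      rw [integral_finsetSum _ fun i _ => ((hρint i).const_mul _).mul_const _]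
      have : ∀ i, ∫ t, m i * ρ t i * p i ∂μ = m i * p i := by
        intro i
        rw [integral_mul_const, integral_const_mul]
        rcases eq_or_ne (m i) 0 with h0 | h0
        · simp [h0]
        · rw [hρclear i h0, mul_one]
      simp only [this, hp0]
    rw [← h1]
    exact integral_mono (integrable_finsetSum _ fun i _ =>
      ((hρint i).const_mul _).mul_const _) (hSint.sub hLint) hent
  refine ⟨R, fun t => ∑ i, m i * ρ t i * u t i - L t, hSm.sub hLm, fun t t' => ?_, fun t => ?_,
    fun t => ?_, hprmean, ?_⟩
  · rw [hRh, hRh]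
    have h1 := htan t t'
    simp only [mul_sub, Finset.sum_sub_distrib] at h1
    linarith
  · rw [hRh]
    have h1 := hjen t
    simp only [mul_sub, Finset.sum_sub_distrib, hp0, sub_zero] at h1
    have h2 : 0 ≤ ∑ i, m i * u t i := Finset.sum_nonneg fun i _ => mul_nonneg (hm0 i) (huB t i).1
    linarith
  · refine le_trans ?_ (hent t)
    have h1 : ∑ i, m i * ρ t i * (-B) ≤ ∑ i, m i * ρ t i * p i :=
      Finset.sum_le_sum fun i _ => mul_le_mul_of_nonneg_left (abs_le.1 (hpB i)).1
        (mul_nonneg (hm0 i) (hρ0 t i))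
    rwa [← Finset.sum_mul, hρ1, one_mul] at h1
  · simp_rw [hRh]
    -- the value of a type at the clearing prices is at least its net utility for its own cell
    have hle : ∀ᵐ t ∂μ, u t (c t) + (Real.log (m (c t)) - p (c t)) ≤ L t := by
      filter_upwards [hae] with t ht
      have := hlow t (c t) (lt_of_le_of_ne (hm0 _) (Ne.symm ht))
      linarith
    have huint : Integrable (fun t => u t (c t)) μ :=
      integrable_of_measurable_of_abs_le
        ((measurable_from_prod_countable_left (f := fun z : S × ι => u z.1 z.2) hum).comp
          (measurable_id.prodMk hc)) (C := B) fun t => by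
        rw [abs_of_nonneg (huB t _).1]; exact (huB t _).2
    have hcint : Integrable (fun t => Real.log (m (c t)) - p (c t)) μ := by
      refine integrable_of_measurable_of_abs_le
        ((measurable_of_countable fun i => Real.log (m i) - p i).comp hc)
        (C := ∑ i, |Real.log (m i) - p i|) fun t => ?_
      exact Finset.single_le_sum (f := fun i => |Real.log (m i) - p i|)
        (fun i _ => abs_nonneg _) (Finset.mem_univ (c t))
    have h1 : ∫ t, (u t (c t) + (Real.log (m (c t)) - p (c t))) ∂μ ≤ ∫ t, L t ∂μ :=
      integral_mono_ae (huint.add hcint) hLint hle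
    have h2 : ∫ t, (Real.log (m (c t)) - p (c t)) ∂μ = ∑ i, m i * Real.log (m i) := by
      rw [hcavg fun i => Real.log (m i) - p i]
      simp only [mul_sub, Finset.sum_sub_distrib, hp0, sub_zero]
    have h3 := neg_card_le_sum_mul_log hm0
    rw [integral_sub hSint hLint] at hprmean
    rw [integral_add huint hcint, h2] at h1
    linarith

/-- **Exact incentives for a measure preserving assignment.** Types in `S` have utility `h t s` for
being assigned the type `s`, and the types are divided into finitely many cells `c`. There are a
measure preserving reassignment and transfers `pr` that are incentive compatible, individually
rational and of nonnegative mean, and whose welfare is, up to an entropy term, at least that of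
assigning to each type a random type in its own cell. The reassignment is softmax demand for cells
at market clearing prices, and the transfers are the prices corrected by an entropy term. -/
theorem exists_typeRemap_of_cells {c : S → ι} (hc : Measurable c) {H : ℝ} {h : S → S → ℝ}
    (hm : Measurable fun z : S × S => h z.1 z.2) (hH : ∀ t s, h t s ∈ Set.Icc 0 H)
    {τ : ℝ} (hτ : 0 < τ) :
    ∃ (R : TypeRemap μ) (pr : S → ℝ), Measurable pr ∧
      (∀ t w, ∫ s, R.density w s * h t s ∂μ - pr w ≤ ∫ s, R.density t s * h t s ∂μ - pr t) ∧
      (∀ t, pr t ≤ ∫ s, R.density t s * h t s ∂μ) ∧ (∀ t, -H ≤ pr t) ∧ 0 ≤ ∫ t, pr t ∂μ ∧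
      ∫ t, cellAverage μ c h t (c t) ∂μ - τ * Fintype.card ι
        ≤ ∫ t, ∫ s, R.density t s * h t s ∂μ ∂μ := by
  obtain ⟨R, pr, h1, h2, h3, h4, h5, h6⟩ := exists_typeRemap_of_cells_aux (μ := μ) hc
    (h := fun t s => h t s / τ) (B := H / τ) (hm.div_const τ) fun t s =>
      ⟨div_nonneg (hH t s).1 hτ.le, div_le_div_of_nonneg_right (hH t s).2 hτ.le⟩
  have hsc : ∀ w t, ∫ s, R.density w s * (h t s / τ) ∂μ = (∫ s, R.density w s * h t s ∂μ) / τ := by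
    intro w t
    simp_rw [← mul_div_assoc]
    rw [integral_div]
  have hav : ∀ t i, cellAverage μ c (fun t s => h t s / τ) t i = cellAverage μ c h t i / τ := by
    intro t i
    unfold cellAverage
    rw [integral_div]; ring
  simp only [hsc, hav, integral_div] at h2 h3 h6
  refine ⟨R, fun t => τ * pr t, h1.const_mul τ, fun t w => ?_, fun t => ?_, fun t => ?_, ?_, ?_⟩
  · have := mul_le_mul_of_nonneg_left (h2 t w) hτ.le
    rwa [mul_sub, mul_sub, mul_div_cancel₀ _ hτ.ne', mul_div_cancel₀ _ hτ.ne'] at this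
  · have := mul_le_mul_of_nonneg_left (h3 t) hτ.le
    rwa [mul_div_cancel₀ _ hτ.ne'] at this
  · have := mul_le_mul_of_nonneg_left (h4 t) hτ.le
    rwa [mul_neg, mul_div_cancel₀ _ hτ.ne'] at this
  · rw [integral_const_mul]; exact mul_nonneg hτ.le h5
  · have := mul_le_mul_of_nonneg_left h6 hτ.le
    rwa [mul_sub, mul_div_cancel₀ _ hτ.ne', mul_div_cancel₀ _ hτ.ne'] at this

end Assignment

/-! ### Finite partitions of a separable type space -/

section Partition

variable {S : Type*} [MeasurableSpace S] {μ : Measure S} [IsProbabilityMeasure μ]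

/-- A family of functions that is separable in the supremum norm can be divided into finitely many
measurable cells of small oscillation, up to a residual cell (the last one) of small mass. The
oscillation is only controlled at almost every point of the cell itself, which is what makes the
cells measurable. -/
lemma exists_cells_of_separable {V : S → S → ℝ} (hV : Measurable fun z : S × S => V z.1 z.2)
    (hsep : ∀ κ : ℝ, 0 < κ → ∃ A : Set S, A.Countable ∧ ∀ t, ∃ s ∈ A, ∀ x, |V t x - V s x| ≤ κ)
    {κ ν : ℝ} (hκ : 0 < κ) (hν : 0 < ν) :
    ∃ (N : ℕ) (c : S → Fin (N + 1)), Measurable c ∧ μ.real (c ⁻¹' {Fin.last N}) ≤ ν ∧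
      ∀ t, c t ≠ Fin.last N → ∀ᵐ s ∂μ, c s = c t → |V t s - V s s| ≤ κ := by
  classical
  obtain ⟨A, hA, hAV⟩ := hsep (κ / 2) (by positivity)
  obtain ⟨t₀⟩ : Nonempty S := nonempty_of_isProbabilityMeasure μ
  obtain ⟨e, rfl⟩ := hA.exists_eq_range (let ⟨s, hs, _⟩ := hAV t₀; ⟨s, hs⟩)
  let p : S → ℕ → Prop := fun t k =>
    (∀ᵐ x ∂μ, |V t x - V (e k) x| ≤ κ / 2) ∧ |V (e k) t - V t t| ≤ κ / 2
  have hVe : ∀ k, Measurable (V (e k)) := fun k => hV.comp measurable_prodMk_left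
  have hpm : ∀ k, MeasurableSet {t | p t k} := by
    intro k
    refine MeasurableSet.inter ?_ ?_
    · have h1 : MeasurableSet {z : S × S | ¬ |V z.1 z.2 - V (e k) z.2| ≤ κ / 2} :=
        (measurableSet_le (hV.sub ((hVe k).comp measurable_snd)).abs measurable_const).compl
      exact measurable_measure_prodMk_left (ν := μ) h1 (measurableSet_singleton 0)
    · exact measurableSet_le
        ((hVe k).sub (hV.comp (measurable_id.prodMk measurable_id))).abs measurable_const
  have hp : ∀ t, ∃ k, p t k := by
    intro t
    obtain ⟨_, ⟨k, rfl⟩, hk⟩ := hAV t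
    exact ⟨k, Filter.Eventually.of_forall hk, by rw [abs_sub_comm]; exact hk t⟩
  let f : S → ℕ := fun t => Nat.find (hp t)
  have hf : Measurable f := measurable_find hp hpm
  have htend : Filter.Tendsto (fun N => μ (f ⁻¹' Set.Ici N)) Filter.atTop (nhds 0) := by
    have h1 := tendsto_measure_iInter_atTop (μ := μ) (s := fun N => f ⁻¹' Set.Ici N)
      (fun N => (hf measurableSet_Ici).nullMeasurableSet)
      (fun a b hab => Set.preimage_mono (Set.Ici_subset_Ici.2 hab)) ⟨0, measure_ne_top _ _⟩
    have h2 : ⋂ N, f ⁻¹' Set.Ici N = ∅ := by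
      ext t
      simp only [Set.mem_iInter, Set.mem_preimage, Set.mem_Ici, Set.mem_empty_iff_false, iff_false,
        not_forall, not_le]
      exact ⟨f t + 1, Nat.lt_succ_self _⟩
    rwa [h2, measure_empty] at h1
  obtain ⟨N, hN⟩ := ((ENNReal.tendsto_nhds_zero.1 htend) (ENNReal.ofReal ν)
    (by simpa using hν)).exists
  let g : ℕ → Fin (N + 1) := fun k => ⟨min k N, by omega⟩
  have hg : ∀ k, g k = Fin.last N ↔ N ≤ k := by
    intro k
    simp [g, Fin.ext_iff]
  refine ⟨N, g ∘ f, (measurable_of_countable g).comp hf, ?_, fun t ht => ?_⟩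
  · have : (g ∘ f) ⁻¹' {Fin.last N} = f ⁻¹' Set.Ici N := by
      ext t
      simp [hg]
    rw [this, measureReal_def]
    exact ENNReal.toReal_le_of_le_ofReal hν.le hN
  · have h1 : f t < N := by
      by_contra h
      exact ht ((hg _).2 (not_lt.1 h))
    filter_upwards [(Nat.find_spec (hp t)).1] with s hs hst
    have h2 : f s = f t := by
      have := congrArg Fin.val hst
      simp only [Function.comp, g] at this
      omega
    have h3 : |V (e (f t)) s - V s s| ≤ κ / 2 := by
      have := (Nat.find_spec (hp s)).2
      rwa [← h2]
    have h4 : |V t s - V (e (f t)) s| ≤ κ / 2 := hs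
    calc |V t s - V s s| ≤ |V t s - V (e (f t)) s| + |V (e (f t)) s - V s s| := abs_sub_le _ _ _
      _ ≤ κ := by linarith

end Partition

/-! ### Reassigned types with an opportunity to leave -/

section Remap

variable {S : Type*} [MeasurableSpace S] {μ : Measure S}

namespace TypeRemap

lemma measurable_density_right (R : TypeRemap μ) (t : S) : Measurable (R.density t) :=
  R.measurable_density.comp measurable_prodMk_left

lemma abs_density_mul_le (R : TypeRemap μ) (t s : S) {x C : ℝ} (hx : |x| ≤ C) :
    |R.density t s * x| ≤ R.bound * C := by
  rw [abs_mul, abs_of_nonneg (R.density_nonneg t s)]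
  exact mul_le_mul (R.density_le t s) hx (abs_nonneg _)
    ((R.density_nonneg t s).trans (R.density_le t s))

lemma integrable_density_mul [IsFiniteMeasure μ] (R : TypeRemap μ) (t : S) {f : S → ℝ}
    (hf : Measurable f) {C : ℝ} (hC : ∀ s, |f s| ≤ C) :
    Integrable (fun s => R.density t s * f s) μ :=
  integrable_of_measurable_of_abs_le ((R.measurable_density_right t).mul hf)
    fun s => R.abs_density_mul_le t s (hC s)

lemma integrable_prod_density_mul [IsFiniteMeasure μ] (R : TypeRemap μ) {f : S → S → ℝ}
    (hf : Measurable fun z : S × S => f z.1 z.2) {C : ℝ} (hC : ∀ t s, |f t s| ≤ C) :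
    Integrable (fun z : S × S => R.density z.1 z.2 * f z.1 z.2) (μ.prod μ) :=
  integrable_of_measurable_of_abs_le (R.measurable_density.mul hf)
    fun z => R.abs_density_mul_le z.1 z.2 (hC z.1 z.2)

lemma measurable_integral_density_mul [SFinite μ] (R : TypeRemap μ) {f : S → S → ℝ}
    (hf : Measurable fun z : S × S => f z.1 z.2) :
    Measurable fun t => ∫ s, R.density t s * f t s ∂μ :=
  (R.measurable_density.mul hf).stronglyMeasurable.integral_prod_right.measurable

lemma integral_density_mul_le [IsFiniteMeasure μ] (R : TypeRemap μ) (t : S) {f : S → ℝ}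
    (hf : Measurable f) {C : ℝ} (hC : ∀ s, f s ∈ Set.Icc 0 C) :
    ∫ s, R.density t s * f s ∂μ ≤ C := by
  have h0 : ∀ s, |f s| ≤ C := fun s => by rw [abs_of_nonneg (hC s).1]; exact (hC s).2
  have hd : Integrable (R.density t) μ := by
    simpa using R.integrable_density_mul t (f := fun _ => 1) measurable_const (C := 1) (by simp)
  calc ∫ s, R.density t s * f s ∂μ ≤ ∫ s, R.density t s * C ∂μ :=
        integral_mono (R.integrable_density_mul t hf h0) (hd.mul_const C)
          fun s => mul_le_mul_of_nonneg_left (hC s).2 (R.density_nonneg t s)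
    _ = C := by rw [integral_mul_const, R.integral_right, one_mul]

/-- The reported type is distributed according to `μ`. -/
lemma integral_integral_density_mul [IsFiniteMeasure μ] (R : TypeRemap μ) {f : S → ℝ}
    (hf : Measurable f) {C : ℝ} (hC : ∀ s, |f s| ≤ C) :
    ∫ t, ∫ s, R.density t s * f s ∂μ ∂μ = ∫ s, f s ∂μ := by
  rw [integral_integral_swap]
  · refine integral_congr_ae ?_
    filter_upwards [R.integral_left] with s hs
    rw [integral_mul_const, hs, one_mul]
  · exact R.integrable_prod_density_mul (f := fun _ s => f s) (hf.comp measurable_snd)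
      fun _ s => hC s

end TypeRemap

variable [IsProbabilityMeasure μ]

/-- The average of `g` over the cell of a random point is the average of `g`. -/
lemma integral_cellAverage {ι : Type*} [Fintype ι] [MeasurableSpace ι]
    [MeasurableSingletonClass ι] {c : S → ι} (hc : Measurable c) {g : S → ℝ} (hg : Integrable g μ)
    (t₀ : S) : ∫ t, cellAverage μ c (fun _ => g) t₀ (c t) ∂μ = ∫ s, g s ∂μ := by
  rw [integral_comp_eq_sum hc]
  simp only [measureReal_mul_cellAverage]
  have := integral_comp_mul_eq_sum hc (fun _ => 1) hg
  simpa using this.symm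

/-- Net utility, nonnegative thanks to the opportunity to leave, of a type `t` facing the outcome
designated for the type `s`, when nonnegative payments are discounted by `η` and negative payments
are dropped. -/
noncomputable def netValue (V : S → S → ℝ) (P : S → ℝ) (η : ℝ) (t s : S) : ℝ :=
  max (V t s - (1 - η) * max (P s) 0) 0

/-- The pairs `(t, s)` such that a type `t` does not want to leave when facing the outcome
designated for the type `s` at the discounted payment. -/
def staySet (V : S → S → ℝ) (P : S → ℝ) (η : ℝ) : Set (S × S) :=
  {z | (1 - η) * max (P z.2) 0 ≤ V z.1 z.2}

omit [MeasurableSpace S] in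
lemma netValue_mem_Icc {V : S → S → ℝ} {H : ℝ} (hVH : ∀ t s, V t s ∈ Set.Icc 0 H) (P : S → ℝ)
    {η : ℝ} (hη1 : η ≤ 1) (t s : S) : netValue V P η t s ∈ Set.Icc 0 H := by
  have h1 : 0 ≤ (1 - η) * max (P s) 0 := mul_nonneg (by linarith) (le_max_right _ _)
  have h2 := hVH t s
  exact ⟨le_max_right _ _, max_le (by linarith [h2.2]) (h2.1.trans h2.2)⟩

lemma measurable_netValue {V : S → S → ℝ} (hV : Measurable fun z : S × S => V z.1 z.2)
    {P : S → ℝ} (hP : Measurable P) (η : ℝ) :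
    Measurable fun z : S × S => netValue V P η z.1 z.2 :=
  (hV.sub (((hP.comp measurable_snd).max measurable_const).const_mul _)).max measurable_const

lemma measurableSet_staySet {V : S → S → ℝ} (hV : Measurable fun z : S × S => V z.1 z.2)
    {P : S → ℝ} (hP : Measurable P) (η : ℝ) : MeasurableSet (staySet V P η) :=
  measurableSet_le (((hP.comp measurable_snd).max measurable_const).const_mul _) hV

/-- Lower bound for the attainable welfare: assigning to each type a random type of its own cell is
nearly as good as truth-telling at the discounted payments. -/
lemma le_integral_cellAverage_netValue {V : S → S → ℝ}
    (hV : Measurable fun z : S × S => V z.1 z.2) {H : ℝ} (hVH : ∀ t s, V t s ∈ Set.Icc 0 H)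
    {P : S → ℝ} (hP : Measurable P) (hPH : ∀ t, P t ∈ Set.Icc (-H) H) {η : ℝ} (hη0 : 0 ≤ η)
    (hη1 : η ≤ 1) {N : ℕ} {c : S → Fin (N + 1)} (hc : Measurable c) {κ ν : ℝ} (hκ : 0 ≤ κ)
    (hν : μ.real (c ⁻¹' {Fin.last N}) ≤ ν)
    (hosc : ∀ t, c t ≠ Fin.last N → ∀ᵐ s ∂μ, c s = c t → |V t s - V s s| ≤ κ) :
    ∫ s, (V s s - (1 - η) * max (P s) 0) ∂μ - κ - H * ν
      ≤ ∫ t, cellAverage μ c (netValue V P η) t (c t) ∂μ := by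
  obtain ⟨t₀⟩ : Nonempty S := nonempty_of_isProbabilityMeasure μ
  have hH : 0 ≤ H := (hVH t₀ t₀).1.trans (hVH t₀ t₀).2
  set g : S → ℝ := fun s => V s s - (1 - η) * max (P s) 0 with hg
  have hgm : Measurable g := (hV.comp (measurable_id.prodMk measurable_id)).sub
    ((hP.max measurable_const).const_mul _)
  have hP0 : ∀ s, 0 ≤ (1 - η) * max (P s) 0 := fun s =>
    mul_nonneg (by linarith) (le_max_right _ _)
  have hPH' : ∀ s, (1 - η) * max (P s) 0 ≤ H := fun s => by
    have : max (P s) 0 ≤ H := max_le (hPH s).2 hH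
    nlinarith [le_max_right (P s) 0]
  have hgint : Integrable g μ := integrable_of_measurable_of_abs_le hgm (C := H) fun s => by
    have h1 := hVH s s
    rw [abs_le]; constructor <;> simp only [hg] <;> linarith [hP0 s, hPH' s, h1.1, h1.2]
  have hnm := measurable_netValue hV hP η
  have hnB := netValue_mem_Icc hVH P hη1
  have hcell : ∀ i, MeasurableSet (c ⁻¹' {i}) := fun i => hc (measurableSet_singleton i)
  have hle : ∀ᵐ t ∂μ, cellAverage μ c (fun _ => g) t₀ (c t)
      - (κ + H * (c ⁻¹' {Fin.last N}).indicator 1 t)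
        ≤ cellAverage μ c (netValue V P η) t (c t) := by
    filter_upwards [ae_measureReal_cell_ne_zero (μ := μ) c] with t ht
    have hm : 0 < μ.real (c ⁻¹' {c t}) := lt_of_le_of_ne measureReal_nonneg (Ne.symm ht)
    have hnint : Integrable (netValue V P η t) μ :=
      integrable_of_measurable_of_abs_le (hnm.comp measurable_prodMk_left) (C := H) fun s => by
        rw [abs_of_nonneg (hnB t s).1]; exact (hnB t s).2
    by_cases hct : c t = Fin.last N
    · have h1 : cellAverage μ c (fun _ => g) t₀ (c t) ≤ H := by
        refine div_le_of_le_mul₀ hm.le hH ?_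
        calc ∫ s in c ⁻¹' {c t}, g s ∂μ ≤ ∫ _s in c ⁻¹' {c t}, H ∂μ :=
              integral_mono hgint.integrableOn (integrable_const _) fun s => by
                simp only [hg]; linarith [hP0 s, (hVH s s).2]
          _ = H * μ.real (c ⁻¹' {c t}) := by simp [mul_comm]
      have h2 : (c ⁻¹' {Fin.last N}).indicator (1 : S → ℝ) t = 1 := by simp [hct]
      rw [h2]
      linarith [(cellAverage_mem_Icc (μ := μ) c hnm hnB t (c t)).1]
    · have h2 : (c ⁻¹' {Fin.last N}).indicator (1 : S → ℝ) t = 0 := by simp [hct]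
      rw [h2, mul_zero, add_zero]
      unfold cellAverage
      rw [sub_le_iff_le_add, div_add' _ _ _ hm.ne']
      refine div_le_div_of_nonneg_right ?_ hm.le
      have h3 : ∫ s in c ⁻¹' {c t}, g s ∂μ ≤ ∫ s in c ⁻¹' {c t}, (netValue V P η t s + κ) ∂μ := by
        refine integral_mono_ae hgint.integrableOn
          (hnint.integrableOn.add (integrable_const _)) ?_
        filter_upwards [ae_restrict_of_ae (hosc t hct), ae_restrict_mem (hcell (c t))] with s hs hsc
        have h4 := (abs_le.1 (hs hsc)).1
        have h5 : V t s - (1 - η) * max (P s) 0 ≤ netValue V P η t s := le_max_left _ _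
        simp only [hg]
        linarith
      rw [integral_add hnint.integrableOn (integrable_const _)] at h3
      simpa [mul_comm] using h3
  have hind : Integrable ((c ⁻¹' {Fin.last N}).indicator (1 : S → ℝ)) μ :=
    (integrable_const (1 : ℝ)).indicator (hcell _)
  have hgcint : Integrable (fun t => cellAverage μ c (fun _ => g) t₀ (c t)) μ :=
    integrable_of_measurable_of_abs_le
      ((measurable_of_countable fun i => cellAverage μ c (fun _ => g) t₀ i).comp hc)
      (C := ∑ i, |cellAverage μ c (fun _ => g) t₀ i|) fun t =>
        Finset.single_le_sum (f := fun i => |cellAverage μ c (fun _ => g) t₀ i|)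
          (fun i _ => abs_nonneg _) (Finset.mem_univ (c t))
  have hnint : Integrable (fun t => cellAverage μ c (netValue V P η) t (c t)) μ :=
    integrable_of_measurable_of_abs_le
      ((measurable_from_prod_countable_left
        (f := fun z : S × Fin (N + 1) => cellAverage μ c (netValue V P η) z.1 z.2)
        (measurable_cellAverage c hnm)).comp (measurable_id.prodMk hc)) (C := H) fun t => by
      have := cellAverage_mem_Icc (μ := μ) c hnm hnB t (c t)
      exact abs_le.2 ⟨by linarith [this.1], this.2⟩
  have h1 := integral_mono_ae (hgcint.sub ((integrable_const κ).add (hind.const_mul H))) hnint hle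
  simp only [Pi.sub_apply, Pi.add_apply] at h1
  have h2 := integral_sub hgcint ((integrable_const κ).add (hind.const_mul H))
  simp only [Pi.add_apply] at h2
  rw [h2, integral_cellAverage hc hgint, integral_add (integrable_const κ) (hind.const_mul H),
    integral_const_mul, integral_indicator_one (hcell _)] at h1
  simp at h1
  have h3 := mul_le_mul_of_nonneg_left hν hH
  linarith

end Remap

/-! ### Exact incentives for one agent -/

section IncentiveRemap

variable {S : Type*} [MeasurableSpace S] {μ : Measure S} [IsProbabilityMeasure μ]

omit [MeasurableSpace S] in
lemma indicator_mem_Icc {A : Set S} {f : S → ℝ} {C : ℝ} (hC : 0 ≤ C)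
    (hf : ∀ x, f x ∈ Set.Icc 0 C) (x : S) : A.indicator f x ∈ Set.Icc 0 C := by
  by_cases hx : x ∈ A
  · rw [Set.indicator_of_mem hx]; exact hf x
  · rw [Set.indicator_of_notMem hx]; exact ⟨le_rfl, hC⟩

/-- The expected value of a type `t` that is reassigned as if it were of type `w`: facing the
outcome designated for `s` it obtains `V t s` if `(w, s)` belongs to the set `K`, and nothing
otherwise. -/
noncomputable def TypeRemap.stayValue (R : TypeRemap μ) (K : Set (S × S)) (V : S → S → ℝ)
    (w t : S) : ℝ :=
  ∫ s, R.density w s * K.indicator (fun z => V t z.2) (w, s) ∂μ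

/-- Upper bound for the attainable welfare: at discounted payments, a measure preserving
reassignment exceeds the utility of truth-telling, net of the subsidies `max (-P s) 0` that are
dropped, at most by the failure of incentive compatibility and by the rebate `η` on the payments of
the types that stay. -/
lemma integral_density_mul_netValue_le {V : S → S → ℝ}
    (hV : Measurable fun z : S × S => V z.1 z.2) {H : ℝ} (hVH : ∀ t s, V t s ∈ Set.Icc 0 H)
    {P : S → ℝ} (hP : Measurable P) (hPH : ∀ t, P t ∈ Set.Icc (-H) H) (hIR : ∀ t, P t ≤ V t t)
    {ε q : ℝ} (hε : 0 ≤ ε) {G : Set S} (hG : MeasurableSet G) (hGq : μ.real Gᶜ ≤ q)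
    (hGε : ∀ t ∈ G, ∀ s, V t s - P s ≤ V t t - P t + ε) {η : ℝ} (hη1 : η ≤ 1)
    (R : TypeRemap μ) :
    ∫ t, ∫ s, R.density t s * netValue V P η t s ∂μ ∂μ
      ≤ ∫ t, (V t t - P t) ∂μ + (ε + 2 * H * q) - ∫ s, max (-P s) 0 ∂μ
        + η * ∫ t, ∫ s, R.density t s *
          (staySet V P η).indicator (fun z => max (P z.2) 0) (t, s) ∂μ ∂μ := by
  obtain ⟨t₀⟩ : Nonempty S := nonempty_of_isProbabilityMeasure μ
  have hH : 0 ≤ H := (hVH t₀ t₀).1.trans (hVH t₀ t₀).2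
  set K := staySet V P η with hK
  have hKm : MeasurableSet K := measurableSet_staySet hV hP η
  let U : S → ℝ := fun t => V t t - P t
  let e : S → ℝ := fun t => ε + Gᶜ.indicator (fun _ => 2 * H) t
  let b : S → S → ℝ := fun t s => K.indicator (fun z => max (P z.2) 0) (t, s)
  have hUm : Measurable U := (hV.comp (measurable_id.prodMk measurable_id)).sub hP
  have hU : ∀ t, U t ∈ Set.Icc 0 (2 * H) := fun t =>
    ⟨sub_nonneg.2 (hIR t), by simp only [U]; linarith [(hVH t t).2, (hPH t).1]⟩
  have hem : Measurable e := (measurable_const.indicator hG.compl).const_add _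
  have he : ∀ t, e t ∈ Set.Icc 0 (ε + 2 * H) := fun t => by
    have := indicator_mem_Icc (A := Gᶜ) (f := fun _ => 2 * H) (C := 2 * H) (by linarith)
      (fun _ => ⟨by linarith, le_rfl⟩) t
    constructor <;> simp only [e] <;> linarith [this.1, this.2]
  have hbm : Measurable fun z : S × S => b z.1 z.2 :=
    ((hP.comp measurable_snd).max measurable_const).indicator hKm
  have hb : ∀ t s, b t s ∈ Set.Icc 0 H := fun t s =>
    indicator_mem_Icc hH (fun z => ⟨le_max_right _ _, max_le (hPH z.2).2 hH⟩) (t, s)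
  have hbabs : ∀ t s, |b t s| ≤ H := fun t s => by rw [abs_of_nonneg (hb t s).1]; exact (hb t s).2
  have hmm : Measurable fun s => max (-P s) 0 := hP.neg.max measurable_const
  have hmabs : ∀ s, |max (-P s) 0| ≤ H := fun s => by
    rw [abs_of_nonneg (le_max_right _ _)]
    exact max_le (by linarith [(hPH s).1]) hH
  have hnm := measurable_netValue hV hP η
  have hn := netValue_mem_Icc hVH P hη1
  have hnabs : ∀ t s, |netValue V P η t s| ≤ H := fun t s => by
    rw [abs_of_nonneg (hn t s).1]; exact (hn t s).2
  have hpt : ∀ t s, netValue V P η t s ≤ U t + e t - max (-P s) 0 + η * b t s := by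
    intro t s
    have h1 : V t s - P s ≤ U t + e t := by
      by_cases ht : t ∈ G
      · have : e t = ε := by simp [e, ht]
        rw [this]; exact hGε t ht s
      · have : e t = ε + 2 * H := by simp [e, ht]
        rw [this]
        linarith [(hVH t s).2, (hPH s).1, (hU t).1]
    by_cases hts : (t, s) ∈ K
    · have h2 : b t s = max (P s) 0 := by simp only [b, Set.indicator_of_mem hts]
      have h3 : (1 - η) * max (P s) 0 ≤ V t s := hts
      have h4 : max (P s) 0 - max (-P s) 0 = P s := max_zero_sub_max_neg_zero_eq_self (P s)
      rw [netValue, h2, max_eq_left (sub_nonneg.2 h3)]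
      linarith
    · have h2 : b t s = 0 := by simp only [b, Set.indicator_of_notMem hts]
      have h3 : V t s < (1 - η) * max (P s) 0 := not_le.1 hts
      -- a type that leaves faces a positive payment
      have h4 : 0 < P s := by
        by_contra h
        rw [max_eq_right (not_lt.1 h), mul_zero] at h3
        linarith [(hVH t s).1]
      rw [netValue, h2, max_eq_right (sub_nonpos.2 h3.le), max_eq_right (by linarith)]
      linarith [(hU t).1, (he t).1]
  have hd : ∀ t, Integrable (R.density t) μ := fun t => by
    simpa using R.integrable_density_mul t (f := fun _ => 1) measurable_const (C := 1) (by simp)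
  have hinner : ∀ t, ∫ s, R.density t s * netValue V P η t s ∂μ ≤
      U t + e t - ∫ s, R.density t s * max (-P s) 0 ∂μ + η * ∫ s, R.density t s * b t s ∂μ := by
    intro t
    have i1 : Integrable (fun s => R.density t s * (U t + e t)) μ := (hd t).mul_const _
    have i2 := R.integrable_density_mul t hmm hmabs
    have i3 : Integrable (fun s => R.density t s * b t s) μ :=
      R.integrable_density_mul t (hbm.comp measurable_prodMk_left) (hbabs t)
    have i12 : Integrable (fun s => R.density t s * (U t + e t)
        - R.density t s * max (-P s) 0) μ := i1.sub i2
    have h1 : ∫ s, R.density t s * netValue V P η t s ∂μ ≤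
        ∫ s, (R.density t s * (U t + e t) - R.density t s * max (-P s) 0
          + η * (R.density t s * b t s)) ∂μ := by
      refine integral_mono (R.integrable_density_mul t (hnm.comp measurable_prodMk_left) (hnabs t))
        (i12.add (i3.const_mul η)) fun s => ?_
      have := mul_le_mul_of_nonneg_left (hpt t s) (R.density_nonneg t s)
      change R.density t s * netValue V P η t s ≤ R.density t s * (U t + e t)
        - R.density t s * max (-P s) 0 + η * (R.density t s * b t s)
      linarith
    rw [integral_add i12 (i3.const_mul η), integral_sub i1 i2, integral_const_mul,
      integral_mul_const, R.integral_right, one_mul] at h1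
    exact h1
  have j1 : Integrable U μ := integrable_of_measurable_of_abs_le hUm (C := 2 * H) fun t => by
    rw [abs_of_nonneg (hU t).1]; exact (hU t).2
  have j2 : Integrable e μ := integrable_of_measurable_of_abs_le hem (C := ε + 2 * H) fun t => by
    rw [abs_of_nonneg (he t).1]; exact (he t).2
  have j3 : Integrable (fun t => ∫ s, R.density t s * max (-P s) 0 ∂μ) μ :=
    (R.integrable_prod_density_mul (f := fun _ s => max (-P s) 0) (hmm.comp measurable_snd)
      fun _ s => hmabs s).integral_prod_left
  have j4 : Integrable (fun t => ∫ s, R.density t s * b t s ∂μ) μ :=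
    (R.integrable_prod_density_mul hbm hbabs).integral_prod_left
  have j5 : Integrable (fun t => ∫ s, R.density t s * netValue V P η t s ∂μ) μ :=
    (R.integrable_prod_density_mul hnm hnabs).integral_prod_left
  have j12 : Integrable (fun t => U t + e t) μ := j1.add j2
  have j123 : Integrable (fun t => U t + e t - ∫ s, R.density t s * max (-P s) 0 ∂μ) μ :=
    j12.sub j3
  have h1 := integral_mono j5 (j123.add (j4.const_mul η)) hinner
  have h2 : ∫ t, (U t + e t - ∫ s, R.density t s * max (-P s) 0 ∂μ
      + η * ∫ s, R.density t s * b t s ∂μ) ∂μ = ∫ t, U t ∂μ + ∫ t, e t ∂μ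
        - ∫ s, max (-P s) 0 ∂μ + η * ∫ t, ∫ s, R.density t s * b t s ∂μ ∂μ := by
    rw [integral_add j123 (j4.const_mul η), integral_sub j12 j3,
      integral_add j1 j2, integral_const_mul, R.integral_integral_density_mul hmm hmabs]
  have h3 : ∫ t, e t ∂μ ≤ ε + 2 * H * q := by
    have : ∫ t, e t ∂μ = ε + 2 * H * μ.real Gᶜ := by
      rw [integral_add (integrable_const _) ((integrable_const _).indicator hG.compl),
        integral_indicator hG.compl]
      simp [mul_comm]
    rw [this]
    have := mul_le_mul_of_nonneg_left hGq (by linarith : 0 ≤ 2 * H)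
    linarith
  have h4 : ∫ t, ∫ s, R.density t s * netValue V P η t s ∂μ ∂μ ≤ ∫ t, U t ∂μ + ∫ t, e t ∂μ
      - ∫ s, max (-P s) 0 ∂μ + η * ∫ t, ∫ s, R.density t s * b t s ∂μ ∂μ := h1.trans_eq h2
  simp only [U, b] at h4 ⊢
  linarith

/-- **From approximate to exact incentive compatibility, for one agent.** `V t s` and `P s` are the
expected value and the expected payment of an agent of type `t` who reports `s`; truth-telling is
individually rational, and `ε`-optimal off a set of types of mass `q`. Then types can be reassigned
in a measure preserving way, letting a type leave when the outcome designated for its new type is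
unfavourable, such that for suitable payments `Q` truth-telling is exactly optimal and individually
rational, at a small loss of revenue. -/
theorem exists_incentive_remap {V : S → S → ℝ}
    (hV : Measurable fun z : S × S => V z.1 z.2) {H : ℝ} (hH : 0 < H)
    (hVH : ∀ t s, V t s ∈ Set.Icc 0 H)
    {P : S → ℝ} (hP : Measurable P) (hPH : ∀ t, P t ∈ Set.Icc (-H) H) (hIR : ∀ t, P t ≤ V t t)
    (hsep : ∀ κ : ℝ, 0 < κ → ∃ A : Set S, A.Countable ∧ ∀ t, ∃ s ∈ A, ∀ x, |V t x - V s x| ≤ κ)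
    {ε q : ℝ} (hε : 0 ≤ ε) {G : Set S} (hG : MeasurableSet G) (hGq : μ.real Gᶜ ≤ q)
    (hGε : ∀ t ∈ G, ∀ s, V t s - P s ≤ V t t - P t + ε) {η : ℝ} (hη0 : 0 < η) (hη1 : η ≤ 1)
    {κ : ℝ} (hκ : 0 < κ) :
    ∃ (R : TypeRemap μ) (K : Set (S × S)) (Q : S → ℝ), MeasurableSet K ∧ Measurable Q ∧
      (∀ t, Q t ∈ Set.Icc (-H) H) ∧
      (∀ t w, R.stayValue K V w t - Q w ≤ R.stayValue K V t t - Q t) ∧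
      (∀ t, Q t ≤ R.stayValue K V t t) ∧
      ∫ t, P t ∂μ - η * H - (ε + 2 * H * q + κ) / η ≤ ∫ t, Q t ∂μ := by
  -- the oscillation in the cells, the residual cell and the entropy cost `κ / 3` each of welfare
  obtain ⟨N, c, hc, hcν, hcosc⟩ := exists_cells_of_separable (μ := μ) hV hsep
    (κ := κ / 3) (ν := κ / (3 * H)) (by positivity) (by positivity)
  have hnm := measurable_netValue hV hP η
  have hn := netValue_mem_Icc hVH P hη1
  have hnabs : ∀ t s, |netValue V P η t s| ≤ H := fun t s => by
    rw [abs_of_nonneg (hn t s).1]; exact (hn t s).2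
  obtain ⟨R, pr, hprm, hic, hir, hprlow, hprmean, hwel⟩ := exists_typeRemap_of_cells (μ := μ) hc
    hnm hn (τ := κ / (3 * (N + 1))) (by positivity)
  have hlow := le_integral_cellAverage_netValue (μ := μ) hV hVH hP hPH hη0.le hη1 hc
    (κ := κ / 3) (by positivity) hcν hcosc
  have hupp := integral_density_mul_netValue_le hV hVH hP hPH hIR hε hG hGq hGε hη1 R
  set K := staySet V P η with hK
  have hKm : MeasurableSet K := measurableSet_staySet hV hP η
  let b : S → S → ℝ := fun t s => K.indicator (fun z => max (P z.2) 0) (t, s)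
  have hbm : Measurable fun z : S × S => b z.1 z.2 :=
    ((hP.comp measurable_snd).max measurable_const).indicator hKm
  have hb : ∀ t s, b t s ∈ Set.Icc 0 H := fun t s =>
    indicator_mem_Icc hH.le (fun z => ⟨le_max_right _ _, max_le (hPH z.2).2 hH.le⟩) (t, s)
  have hbabs : ∀ t s, |b t s| ≤ H := fun t s => by rw [abs_of_nonneg (hb t s).1]; exact (hb t s).2
  let v : S → S → S → ℝ := fun w t s => K.indicator (fun z => V t z.2) (w, s)
  have hvm : ∀ w t, Measurable (v w t) := fun w t =>
    (((hV.comp measurable_prodMk_left).comp measurable_snd).indicator hKm).comp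
      measurable_prodMk_left
  have hv : ∀ w t s, v w t s ∈ Set.Icc 0 H := fun w t s =>
    indicator_mem_Icc hH.le (fun z => hVH t z.2) (w, s)
  have hvabs : ∀ w t s, |v w t s| ≤ H := fun w t s => by
    rw [abs_of_nonneg (hv w t s).1]; exact (hv w t s).2
  have hsv : ∀ w t, R.stayValue K V w t = ∫ s, R.density w s * v w t s ∂μ := fun w t => rfl
  -- the expected undiscounted payment of a type that leaves whenever it prefers to
  let A : S → ℝ := fun t => ∫ s, R.density t s * b t s ∂μ
  have hAm : Measurable A := R.measurable_integral_density_mul hbm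
  have hA : ∀ t, A t ∈ Set.Icc 0 H := fun t =>
    ⟨integral_nonneg fun s => mul_nonneg (R.density_nonneg t s) (hb t s).1,
      R.integral_density_mul_le t (hbm.comp measurable_prodMk_left) (hb t)⟩
  have hAint : Integrable A μ := integrable_of_measurable_of_abs_le hAm (C := H) fun t => by
    rw [abs_of_nonneg (hA t).1]; exact (hA t).2
  have hsub : ∀ w t, R.stayValue K V w t - (1 - η) * A w
      = ∫ s, R.density w s * (v w t s - (1 - η) * b w s) ∂μ := by
    intro w t
    have i1 := R.integrable_density_mul w (hvm w t) (hvabs w t)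
    have i2 : Integrable (fun s => R.density w s * b w s) μ :=
      R.integrable_density_mul w (hbm.comp measurable_prodMk_left) (hbabs w)
    rw [hsv, ← integral_const_mul, ← integral_sub i1 (i2.const_mul _)]
    refine integral_congr_ae (Filter.Eventually.of_forall fun s => ?_)
    change R.density w s * v w t s - (1 - η) * (R.density w s * b w s) = _
    ring
  -- deciding to leave as a type `w` would is no better for `t` than deciding optimally
  have hle : ∀ w t, R.stayValue K V w t - (1 - η) * A w
      ≤ ∫ s, R.density w s * netValue V P η t s ∂μ := by
    intro w t
    rw [hsub]
    refine integral_mono (R.integrable_density_mul w (C := H + |1 - η| * H)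
      ((hvm w t).sub ((hbm.comp measurable_prodMk_left).const_mul _)) fun s => ?_)
      (R.integrable_density_mul w (hnm.comp measurable_prodMk_left) (hnabs t)) fun s => ?_
    · refine (abs_sub _ _).trans (add_le_add (hvabs w t s) ?_)
      rw [abs_mul]
      exact mul_le_mul_of_nonneg_left (hbabs w s) (abs_nonneg _)
    · refine mul_le_mul_of_nonneg_left ?_ (R.density_nonneg w s)
      by_cases hws : (w, s) ∈ K
      · simp only [v, b, Set.indicator_of_mem hws, netValue]
        exact le_max_left _ _
      · simp only [v, b, Set.indicator_of_notMem hws, netValue, mul_zero, sub_zero]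
        exact le_max_right _ _
  have heq : ∀ t, R.stayValue K V t t - (1 - η) * A t
      = ∫ s, R.density t s * netValue V P η t s ∂μ := by
    intro t
    rw [hsub]
    refine integral_congr_ae (Filter.Eventually.of_forall fun s => ?_)
    dsimp only
    congr 1
    by_cases hts : (t, s) ∈ K
    · have h3 : (1 - η) * max (P s) 0 ≤ V t s := hts
      simp only [v, b, Set.indicator_of_mem hts, netValue]
      rw [max_eq_left (sub_nonneg.2 h3)]
    · have h3 : V t s < (1 - η) * max (P s) 0 := not_le.1 hts
      simp only [v, b, Set.indicator_of_notMem hts, netValue, mul_zero, sub_zero]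
      rw [max_eq_right (sub_nonpos.2 h3.le)]
  have hirQ : ∀ t, (1 - η) * A t + pr t ≤ R.stayValue K V t t := fun t => by
    have h1 := heq t
    have h2 := hir t
    linarith
  have hsvH : ∀ t, R.stayValue K V t t ≤ H := fun t => by
    rw [hsv]; exact R.integral_density_mul_le t (hvm t t) (hv t t)
  have hQlow : ∀ t, -H ≤ (1 - η) * A t + pr t := fun t => by
    have := mul_nonneg (by linarith : 0 ≤ 1 - η) (hA t).1
    linarith [hprlow t]
  have hprint : Integrable pr μ := integrable_of_measurable_of_abs_le hprm (C := 2 * H) fun t => by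
    have h1 := mul_nonneg (by linarith : 0 ≤ 1 - η) (hA t).1
    exact abs_le.2 ⟨by linarith [hprlow t], by linarith [hirQ t, hsvH t]⟩
  refine ⟨R, K, fun t => (1 - η) * A t + pr t, hKm, (hAm.const_mul _).add hprm,
    fun t => ⟨hQlow t, (hirQ t).trans (hsvH t)⟩, fun t w => ?_, hirQ, ?_⟩
  · have h1 := hle w t
    have h2 := heq t
    have h3 := hic t w
    linarith
  · rw [integral_add (hAint.const_mul _) hprint, integral_const_mul]
    have hpp : Integrable (fun s => max (P s) 0) μ :=
      integrable_of_measurable_of_abs_le (hP.max measurable_const) (C := H) fun s => by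
        rw [abs_of_nonneg (le_max_right _ _)]; exact max_le (hPH s).2 hH.le
    have hpm : Integrable (fun s => max (-P s) 0) μ :=
      integrable_of_measurable_of_abs_le (hP.neg.max measurable_const) (C := H) fun s => by
        rw [abs_of_nonneg (le_max_right _ _)]; exact max_le (by linarith [(hPH s).1]) hH.le
    have hPint : Integrable P μ := integrable_of_measurable_of_abs_le hP (C := H) fun s =>
      abs_le.2 (hPH s)
    have hVdint : Integrable (fun s => V s s) μ :=
      integrable_of_measurable_of_abs_le (hV.comp (measurable_id.prodMk measurable_id)) (C := H)
        fun s => by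
          rw [abs_of_nonneg (hVH s s).1]; exact (hVH s s).2
    have e1 : ∫ s, P s ∂μ = ∫ s, max (P s) 0 ∂μ - ∫ s, max (-P s) 0 ∂μ := by
      rw [← integral_sub hpp hpm]
      simp only [max_zero_sub_max_neg_zero_eq_self]
    rw [integral_sub hVdint (hpp.const_mul _), integral_const_mul] at hlow
    rw [integral_sub hVdint hPint] at hupp
    have hpm0 : 0 ≤ ∫ s, max (-P s) 0 ∂μ := integral_nonneg fun s => le_max_right _ _
    have hppH : ∫ s, max (P s) 0 ∂μ ≤ H := by
      have := integral_mono hpp (integrable_const H) fun s => max_le (hPH s).2 hH.le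
      simpa using this
    have hA0 : 0 ≤ ∫ t, A t ∂μ := integral_nonneg fun t => (hA t).1
    have e2 : κ / (3 * (N + 1)) * (Fintype.card (Fin (N + 1)) : ℝ) = κ / 3 := by
      rw [Fintype.card_fin]; push_cast; field_simp
    have e3 : H * (κ / (3 * H)) = κ / 3 := by field_simp
    rw [e2] at hwel
    rw [e3] at hlow
    change _ ≤ _ + η * ∫ t, A t ∂μ at hupp
    -- comparing the two bounds on the welfare bounds the payments lost to types that leave
    have h1 : η * (∫ s, max (P s) 0 ∂μ - ∫ t, A t ∂μ) ≤ ε + 2 * H * q + κ := by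
      linarith
    have h2 : ∫ s, max (P s) 0 ∂μ - ∫ t, A t ∂μ ≤ (ε + 2 * H * q + κ) / η := by
      rw [le_div_iff₀ hη0, mul_comm]; exact h1
    have h3 : 0 ≤ (ε + 2 * H * q + κ) / η := by
      have : 0 ≤ q := measureReal_nonneg.trans hGq
      positivity
    have h4 : (1 - η) * (∫ s, max (P s) 0 ∂μ - ∫ t, A t ∂μ) ≤ (ε + 2 * H * q + κ) / η := by
      nlinarith
    nlinarith

end IncentiveRemap

/-! ### Allocation rules with one report reassigned -/

section Reassign

variable {n : ℕ} {T : Fin n → Type u} [∀ i, MeasurableSpace (T i)]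
  {X : Type v} [MeasurableSpace X] {H : ℝ}

lemma measurePreserving_update (μ : ∀ i, Measure (T i)) [∀ i, IsProbabilityMeasure (μ i)]
    (i : Fin n) :
    MeasurePreserving (fun z : (∀ i, T i) × T i => Function.update z.1 i z.2)
      ((Measure.pi μ).prod (μ i)) (Measure.pi μ) := by
  refine ⟨measurable_update', (Measure.pi_eq fun s hs => ?_).symm⟩
  rw [Measure.map_apply measurable_update' (MeasurableSet.univ_pi hs)]
  have : (fun z : (∀ i, T i) × T i => Function.update z.1 i z.2) ⁻¹' Set.univ.pi s
      = (Set.univ.pi (Function.update s i Set.univ)) ×ˢ s i := by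
    ext ⟨t, x⟩
    simp only [Set.mem_preimage, Set.mem_univ_pi, Set.mem_prod]
    constructor
    · intro h
      refine ⟨fun j => ?_, by simpa using h i⟩
      rcases eq_or_ne j i with rfl | hj
      · simp
      · simpa [hj] using h j
    · rintro ⟨h1, h2⟩ j
      rcases eq_or_ne j i with rfl | hj
      · simpa using h2
      · simpa [hj] using h1 j
  rw [this, Measure.prod_prod, Measure.pi_pi, ← Finset.mul_prod_erase _ _ (Finset.mem_univ i),
    ← Finset.mul_prod_erase _ (fun j => μ j (s j)) (Finset.mem_univ i)]
  simp only [Function.update_self, measure_univ, one_mul]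
  rw [mul_comm]
  congr 1
  refine Finset.prod_congr rfl fun j hj => ?_
  rw [Function.update_of_ne (Finset.ne_of_mem_erase hj)]

variable (μ : ∀ i, Measure (T i)) [∀ i, IsProbabilityMeasure (μ i)]

/-- Resampling one coordinate of a random type profile with independent coordinates does not change
its distribution. -/
lemma integral_integral_update (i : Fin n) {f : (∀ i, T i) → ℝ} (hf : Measurable f) {C : ℝ}
    (hC : ∀ t, |f t| ≤ C) :
    ∫ t, ∫ s, f (Function.update t i s) ∂(μ i) ∂(Measure.pi μ) = ∫ t, f t ∂(Measure.pi μ) := by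
  have hint : Integrable (fun z : (∀ i, T i) × T i => f (Function.update z.1 i z.2))
      ((Measure.pi μ).prod (μ i)) :=
    integrable_of_measurable_of_abs_le (hf.comp measurable_update') fun z => hC _
  conv_rhs => rw [← (measurePreserving_update μ i).map_eq]
  rw [integral_map measurable_update'.aemeasurable hf.aestronglyMeasurable, integral_prod _ hint]

/-- Expected value of a type `ti` of agent `i` for the allocation when the reports are `b`. -/
noncomputable def Environment.allocValue (E : Environment T X H) (x : Kernel (∀ i, T i) X)
    (i : Fin n) (ti : T i) (b : ∀ i, T i) : ℝ :=
  ∫ A, E.val i ti A ∂(x b)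

/-- Expected value of a type `ti` of agent `i` who reports `wi` when the other agents report
truthfully and the types are independent. -/
noncomputable def Environment.interimValue (E : Environment T X H) (x : Kernel (∀ i, T i) X)
    (i : Fin n) (ti wi : T i) : ℝ :=
  ∫ t, E.allocValue x i ti (Function.update t i wi) ∂(Measure.pi μ)

section Bounds

variable (E : Environment T X H) (x : Kernel (∀ i, T i) X) [IsMarkovKernel x] (i : Fin n)

lemma Environment.measurable_val_right (ti : T i) : Measurable (E.val i ti) :=
  (E.measurable_val i).comp measurable_prodMk_left

lemma Environment.abs_val_le (ti : T i) (A : X) : |E.val i ti A| ≤ H := by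
  rw [abs_of_nonneg (E.val_nonneg i ti A)]; exact E.val_le i ti A

lemma Environment.integrable_val {m : Measure X} [IsFiniteMeasure m] (ti : T i) :
    Integrable (E.val i ti) m :=
  integrable_of_measurable_of_abs_le (E.measurable_val_right i ti) (E.abs_val_le i ti)

lemma Environment.allocValue_mem_Icc (ti : T i) (b : ∀ i, T i) :
    E.allocValue x i ti b ∈ Set.Icc 0 H := by
  refine ⟨integral_nonneg fun A => E.val_nonneg i ti A, ?_⟩
  have := integral_mono (μ := x b) (E.integrable_val i ti) (integrable_const H)
    fun A => E.val_le i ti A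
  simpa [Environment.allocValue] using this

lemma Environment.abs_allocValue_le (ti : T i) (b : ∀ i, T i) :
    |E.allocValue x i ti b| ≤ H := by
  rw [abs_of_nonneg (E.allocValue_mem_Icc x i ti b).1]; exact (E.allocValue_mem_Icc x i ti b).2

omit [IsMarkovKernel x] in
lemma Environment.measurable_allocValue [IsSFiniteKernel x] :
    Measurable fun z : T i × (∀ i, T i) => E.allocValue x i z.1 z.2 := by
  have h : StronglyMeasurable fun z : (T i × (∀ i, T i)) × X => E.val i z.1.1 z.2 :=
    ((E.measurable_val i).comp
      (measurable_fst.fst.prodMk measurable_snd)).stronglyMeasurable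
  exact (h.integral_kernel_prod_right' (κ := x.comap Prod.snd measurable_snd)).measurable

lemma Environment.measurable_allocValue_right (ti : T i) :
    Measurable (E.allocValue x i ti) :=
  (E.measurable_allocValue x i).comp measurable_prodMk_left

lemma Environment.measurable_interimValue :
    Measurable fun z : T i × T i => E.interimValue μ x i z.1 z.2 := by
  have h : Measurable fun z : (T i × T i) × (∀ i, T i) =>
      E.allocValue x i z.1.1 (Function.update z.2 i z.1.2) :=
    (E.measurable_allocValue x i).comp
      (measurable_fst.fst.prodMk (measurable_update'.comp
        (measurable_snd.prodMk measurable_fst.snd)))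
  exact h.stronglyMeasurable.integral_prod_right'.measurable

lemma Environment.integrable_allocValue_update (ti wi : T i) :
    Integrable (fun t => E.allocValue x i ti (Function.update t i wi)) (Measure.pi μ) :=
  integrable_of_measurable_of_abs_le ((E.measurable_allocValue_right x i ti).comp
    (measurable_update_left)) fun _ => E.abs_allocValue_le x i ti _

lemma Environment.interimValue_mem_Icc (ti wi : T i) :
    E.interimValue μ x i ti wi ∈ Set.Icc 0 H := by
  refine ⟨integral_nonneg fun t => (E.allocValue_mem_Icc x i ti _).1, ?_⟩
  have := integral_mono (E.integrable_allocValue_update μ x i ti wi) (integrable_const H)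
    fun t => (E.allocValue_mem_Icc x i ti _).2
  simpa [Environment.interimValue] using this

lemma Environment.abs_interimValue_sub_le {ti si : T i} {κ : ℝ}
    (h : ∀ A, |E.val i ti A - E.val i si A| ≤ κ) (wi : T i) :
    |E.interimValue μ x i ti wi - E.interimValue μ x i si wi| ≤ κ := by
  have h1 : ∀ b, |E.allocValue x i ti b - E.allocValue x i si b| ≤ κ := fun b => by
    unfold Environment.allocValue
    rw [← integral_sub (E.integrable_val i ti) (E.integrable_val i si)]
    have := norm_integral_le_of_norm_le_const (μ := x b)
      (Filter.Eventually.of_forall fun A => (Real.norm_eq_abs _).trans_le (h A))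
    simpa using this
  unfold Environment.interimValue
  rw [← integral_sub (E.integrable_allocValue_update μ x i ti wi)
    (E.integrable_allocValue_update μ x i si wi)]
  have := norm_integral_le_of_norm_le_const (μ := Measure.pi μ)
    (Filter.Eventually.of_forall fun t =>
      (Real.norm_eq_abs _).trans_le (h1 (Function.update t i wi)))
  simpa using this

end Bounds

variable {μ}

/-- The report of agent `i` reassigned according to `R`, the other reports being unchanged. -/
noncomputable def TypeRemap.kernel {i : Fin n} (R : TypeRemap (μ i)) : Kernel (∀ i, T i) (T i) :=
  (Kernel.const _ (μ i)).withDensity fun t s => ENNReal.ofReal (R.density (t i) s)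

lemma TypeRemap.kernel_apply {i : Fin n} (R : TypeRemap (μ i)) (t : ∀ i, T i) :
    R.kernel t = (μ i).withDensity fun s => ENNReal.ofReal (R.density (t i) s) := by
  unfold TypeRemap.kernel
  rw [Kernel.withDensity_apply, Kernel.const_apply]
  exact (R.measurable_density.comp
    (((measurable_pi_apply i).comp measurable_fst).prodMk measurable_snd)).ennreal_ofReal

lemma TypeRemap.integral_kernel {i : Fin n} (R : TypeRemap (μ i)) (t : ∀ i, T i) (f : T i → ℝ) :
    ∫ s, f s ∂(R.kernel t) = ∫ s, R.density (t i) s * f s ∂(μ i) := by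
  rw [R.kernel_apply, integral_withDensity_eq_integral_toReal_smul
    (R.measurable_density_right (t i)).ennreal_ofReal
    (Filter.Eventually.of_forall fun _ => ENNReal.ofReal_lt_top)]
  simp only [ENNReal.toReal_ofReal (R.density_nonneg _ _), smul_eq_mul]

instance TypeRemap.isMarkovKernel_kernel {i : Fin n} (R : TypeRemap (μ i)) :
    IsMarkovKernel R.kernel := by
  refine ⟨fun t => ⟨?_⟩⟩
  have hd : Integrable (R.density (t i)) (μ i) := by
    simpa using R.integrable_density_mul (t i) (f := fun _ => 1) measurable_const (C := 1) (by simp)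
  rw [R.kernel_apply, withDensity_apply _ MeasurableSet.univ, Measure.restrict_univ,
    ← ofReal_integral_eq_lintegral_ofReal hd
      (Filter.Eventually.of_forall fun s => R.density_nonneg _ _), R.integral_right,
    ENNReal.ofReal_one]

/-- The allocation rule `x` with the report `t i` of agent `i` replaced by a random report `s`, and
with agent `i` left out when `(t i, s)` is not in `K`. -/
noncomputable def Environment.reassign (E : Environment T X H) (x : Kernel (∀ i, T i) X)
    {i : Fin n} (R : TypeRemap (μ i)) {K : Set (T i × T i)} (hK : MeasurableSet K) :
    Kernel (∀ i, T i) X :=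
  open Classical in
  have hK' : MeasurableSet {z : (∀ i, T i) × T i | (z.1 i, z.2) ∈ K} :=
    (((measurable_pi_apply i).comp measurable_fst).prodMk measurable_snd) hK
  let y := x.comap (fun z : (∀ i, T i) × T i => Function.update z.1 i z.2) measurable_update'
  Kernel.snd (R.kernel ⊗ₖ Kernel.piecewise hK' y (y.map (E.without i)))

section ReassignLemmas

variable (E : Environment T X H) (x : Kernel (∀ i, T i) X) [IsMarkovKernel x] {i : Fin n}
  (R : TypeRemap (μ i)) {K : Set (T i × T i)} (hK : MeasurableSet K)

instance Environment.isMarkovKernel_reassign : IsMarkovKernel (E.reassign x R hK) := by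
  unfold Environment.reassign
  have := Kernel.IsMarkovKernel.map (x.comap (fun z : (∀ i, T i) × T i => Function.update z.1 i z.2)
    measurable_update') (E.measurable_without i)
  infer_instance

open Classical in
lemma Environment.integral_reassign {f : X → ℝ} (hf : Measurable f) {C : ℝ}
    (hC : ∀ A, |f A| ≤ C) (t : ∀ i, T i) :
    ∫ A, f A ∂(E.reassign x R hK t) = ∫ s, R.density (t i) s *
      (if (t i, s) ∈ K then ∫ A, f A ∂(x (Function.update t i s))
        else ∫ A, f (E.without i A) ∂(x (Function.update t i s))) ∂(μ i) := by
  have := Kernel.IsMarkovKernel.map (x.comap (fun z : (∀ i, T i) × T i => Function.update z.1 i z.2)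
    measurable_update') (E.measurable_without i)
  unfold Environment.reassign
  simp only
  rw [Kernel.snd_apply, integral_map measurable_snd.aemeasurable hf.aestronglyMeasurable,
    integral_compProd (f := fun z : T i × X => f z.2)
      (integrable_of_measurable_of_abs_le (hf.comp measurable_snd) fun z => hC z.2),
    R.integral_kernel]
  congr 1
  ext s
  rw [Kernel.piecewise_apply]
  simp only [Set.mem_ofPred_eq]
  split_ifs with h
  · rw [Kernel.comap_apply]
  · rw [Kernel.map_apply _ (E.measurable_without i), integral_map
      (E.measurable_without i).aemeasurable hf.aestronglyMeasurable, Kernel.comap_apply]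

lemma Environment.allocValue_reassign_of_ne {j : Fin n} (hj : j ≠ i) (tj : T j) (t : ∀ i, T i) :
    E.allocValue (E.reassign x R hK) j tj t
      = ∫ s, R.density (t i) s * E.allocValue x j tj (Function.update t i s) ∂(μ i) := by
  classical
  unfold Environment.allocValue
  rw [E.integral_reassign x R hK (E.measurable_val_right j tj) (E.abs_val_le j tj)]
  simp only [E.val_without_of_ne i j hj, ite_self]

lemma Environment.allocValue_reassign_self (ti : T i) (t : ∀ i, T i) :
    E.allocValue (E.reassign x R hK) i ti t = ∫ s, R.density (t i) s *
      K.indicator (fun z => E.allocValue x i ti (Function.update t i z.2)) (t i, s) ∂(μ i) := by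
  classical
  unfold Environment.allocValue
  rw [E.integral_reassign x R hK (E.measurable_val_right i ti) (E.abs_val_le i ti)]
  simp only [E.val_without_self, integral_zero, Set.indicator_apply]

/-- Since the reassigned report of agent `i` is distributed like her type, the other agents do not
notice the reassignment. -/
lemma Environment.interimValue_reassign_of_ne {j : Fin n} (hj : j ≠ i) (tj wj : T j) :
    E.interimValue μ (E.reassign x R hK) j tj wj = E.interimValue μ x j tj wj := by
  unfold Environment.interimValue
  simp only [E.allocValue_reassign_of_ne x R hK hj]
  let g : (∀ i, T i) → ℝ := fun t => E.allocValue x j tj (Function.update t j wj)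
  have hg : Measurable g := (E.measurable_allocValue_right x j tj).comp measurable_update_left
  have hgH : ∀ t, |g t| ≤ H := fun t => E.abs_allocValue_le x j tj _
  have hupd : Measurable fun z : (∀ i, T i) × T i => Function.update z.1 i z.2 := measurable_update'
  have h1 : ∀ t : ∀ i, T i, ∫ s, R.density (Function.update t j wj i) s *
      E.allocValue x j tj (Function.update (Function.update t j wj) i s) ∂(μ i)
      = ∫ s, R.density (t i) s * g (Function.update t i s) ∂(μ i) := by
    intro t
    simp only [g, Function.update_of_ne hj.symm, Function.update_comm hj.symm]
  simp only [h1]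
  have hFm : Measurable fun t : ∀ i, T i =>
      ∫ s, R.density (t i) s * g (Function.update t i s) ∂(μ i) := by
    have : Measurable fun z : (∀ i, T i) × T i =>
        R.density (z.1 i) z.2 * g (Function.update z.1 i z.2) :=
      (R.measurable_density.comp
        (((measurable_pi_apply i).comp measurable_fst).prodMk measurable_snd)).mul (hg.comp hupd)
    exact this.stronglyMeasurable.integral_prod_right'.measurable
  have hFb : ∀ t : ∀ i, T i,
      |∫ s, R.density (t i) s * g (Function.update t i s) ∂(μ i)| ≤ R.bound * H := by
    intro t
    have := norm_integral_le_of_norm_le_const (μ := μ i) (Filter.Eventually.of_forall fun s =>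
      (Real.norm_eq_abs _).trans_le (R.abs_density_mul_le (t i) s (hgH (Function.update t i s))))
    simpa using this
  rw [← integral_integral_update μ i hFm hFb, ← integral_integral_update μ i hg hgH]
  refine integral_congr_ae (Filter.Eventually.of_forall fun t => ?_)
  simp only [Function.update_self, Function.update_idem]
  exact R.integral_integral_density_mul (f := fun s => g (Function.update t i s))
    (hg.comp (hupd.comp measurable_prodMk_left)) fun s => hgH _

lemma Environment.interimValue_reassign_self (ti wi : T i) :
    E.interimValue μ (E.reassign x R hK) i ti wi
      = R.stayValue K (E.interimValue μ x i) wi ti := by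
  unfold Environment.interimValue TypeRemap.stayValue
  simp only [E.allocValue_reassign_self x R hK, Function.update_self, Function.update_idem]
  have hupd : Measurable fun z : (∀ i, T i) × T i => Function.update z.1 i z.2 := measurable_update'
  have hKw : MeasurableSet {z : (∀ i, T i) × T i | (wi, z.2) ∈ K} :=
    (measurable_const.prodMk measurable_snd) hK
  have hfm : Measurable fun z : (∀ i, T i) × T i =>
      K.indicator (fun y => E.allocValue x i ti (Function.update z.1 i y.2)) (wi, z.2) :=
    ((E.measurable_allocValue_right x i ti).comp hupd).indicator hKw
  have hfb : ∀ z : (∀ i, T i) × T i,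
      |K.indicator (fun y => E.allocValue x i ti (Function.update z.1 i y.2)) (wi, z.2)| ≤ H := by
    intro z
    have hH : 0 ≤ H := (E.allocValue_mem_Icc x i ti z.1).1.trans (E.allocValue_mem_Icc x i ti z.1).2
    have := indicator_mem_Icc (A := K) hH
      (fun y => E.allocValue_mem_Icc x i ti (Function.update z.1 i y.2)) (wi, z.2)
    rw [abs_of_nonneg this.1]; exact this.2
  rw [integral_integral_swap]
  · refine integral_congr_ae (Filter.Eventually.of_forall fun s => ?_)
    simp only
    rw [integral_const_mul]
    congr 1
    by_cases h : (wi, s) ∈ K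
    · simp only [Set.indicator_of_mem h]
    · simp only [Set.indicator_of_notMem h, integral_zero]
  · exact integrable_of_measurable_of_abs_le
      (((R.measurable_density_right wi).comp measurable_snd).mul hfm)
      fun z => R.abs_density_mul_le wi z.2 (hfb z)

end ReassignLemmas

end Reassign

/-! ### From approximate to exact incentive compatibility -/

section IncentiveMechanism

variable {n : ℕ} {T : Fin n → Type u} [∀ i, MeasurableSpace (T i)]
  {X : Type v} [MeasurableSpace X] {H : ℝ}
  (μ : ∀ i, Measure (T i)) [∀ i, IsProbabilityMeasure (μ i)] (E : Environment T X H)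

/-- The types of the agents in `A` can be reassigned one agent after the other, as this does not
affect the interim values of the other agents. -/
theorem Environment.exists_incentive_allocation (hH : 0 < H) (hsep : E.SeparableValuations)
    (x₀ : Kernel (∀ i, T i) X) [IsMarkovKernel x₀] {P : ∀ i, T i → ℝ} (hP : ∀ i, Measurable (P i))
    (hPH : ∀ i t, P i t ∈ Set.Icc (-H) H) (hIR : ∀ i t, P i t ≤ E.interimValue μ x₀ i t t)
    {ε q : ℝ} (hε : 0 ≤ ε) {G : ∀ i, Set (T i)} (hG : ∀ i, MeasurableSet (G i))
    (hGq : ∀ i, (μ i).real (G i)ᶜ ≤ q)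
    (hGε : ∀ i, ∀ t ∈ G i, ∀ s, E.interimValue μ x₀ i t s - P i s
      ≤ E.interimValue μ x₀ i t t - P i t + ε)
    {η : ℝ} (hη0 : 0 < η) (hη1 : η ≤ 1) {κ : ℝ} (hκ : 0 < κ) (A : Finset (Fin n)) :
    ∃ (x : Kernel (∀ i, T i) X) (_ : IsMarkovKernel x) (Q : ∀ i, T i → ℝ),
      (∀ i ∉ A, ∀ t s, E.interimValue μ x i t s = E.interimValue μ x₀ i t s) ∧
      ∀ i ∈ A, Measurable (Q i) ∧ (∀ t, Q i t ∈ Set.Icc (-H) H) ∧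
        (∀ t w, E.interimValue μ x i t w - Q i w ≤ E.interimValue μ x i t t - Q i t) ∧
        (∀ t, Q i t ≤ E.interimValue μ x i t t) ∧
        ∫ t, P i t ∂(μ i) - η * H - (ε + 2 * H * q + κ) / η ≤ ∫ t, Q i t ∂(μ i) := by
  induction A using Finset.induction_on with
  | empty => exact ⟨x₀, inferInstance, P, fun _ _ _ _ => rfl, fun i hi => absurd hi (by simp)⟩
  | insert i A hi ih =>
    obtain ⟨x, hx, Q, hne, hQ⟩ := ih
    have hV : ∀ t s, E.interimValue μ x i t s = E.interimValue μ x₀ i t s := hne i hi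
    obtain ⟨R, K, Qi, hK, hQm, hQH, hic, hir, hrev⟩ := exists_incentive_remap (μ := μ i)
      (E.measurable_interimValue μ x i) hH (E.interimValue_mem_Icc μ x i) (hP i) (hPH i)
      (fun t => by rw [hV]; exact hIR i t)
      (fun κ hκ => by
        obtain ⟨S, hS, h⟩ := hsep i κ hκ
        refine ⟨S, hS, fun t => ?_⟩
        obtain ⟨s, hs, hts⟩ := h t
        exact ⟨s, hs, E.abs_interimValue_sub_le μ x i hts⟩)
      hε (hG i) (hGq i) (fun t ht s => by rw [hV, hV]; exact hGε i t ht s) hη0 hη1 hκ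
    refine ⟨E.reassign x R hK, inferInstance, Function.update Q i Qi, fun j hj t s => ?_,
      fun j hj => ?_⟩
    · rw [Finset.mem_insert, not_or] at hj
      rw [E.interimValue_reassign_of_ne x R hK hj.1, hne j hj.2]
    · rcases eq_or_ne j i with rfl | hji
      · simp only [Function.update_self, E.interimValue_reassign_self x R hK]
        exact ⟨hQm, hQH, hic, hir, hrev⟩
      · simp only [Function.update_of_ne hji, E.interimValue_reassign_of_ne x R hK hji]
        exact hQ j (Finset.mem_of_mem_insert_of_ne hj hji)

section InterimPayment

/-- Expected payment of agent `i` who reports `wi` when the other agents report truthfully and the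
types are independent. -/
noncomputable def Mechanism.interimPay (M : Mechanism T X H) (i : Fin n) (wi : T i) : ℝ :=
  ∫ t, M.pay (Function.update t i wi) i ∂(Measure.pi μ)

lemma Mechanism.abs_pay_le (M : Mechanism T X H) (t : ∀ i, T i) (i : Fin n) : |M.pay t i| ≤ H :=
  abs_le.2 (M.pay_mem t i)

lemma Mechanism.measurable_interimPay (M : Mechanism T X H) (i : Fin n) :
    Measurable (M.interimPay μ i) := by
  have h : Measurable fun z : T i × (∀ i, T i) => M.pay (Function.update z.2 i z.1) i :=
    (M.measurable_pay i).comp (measurable_update'.comp (measurable_snd.prodMk measurable_fst))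
  exact h.stronglyMeasurable.integral_prod_right'.measurable

lemma Mechanism.integrable_pay_update (M : Mechanism T X H) (i : Fin n) (wi : T i) :
    Integrable (fun t => M.pay (Function.update t i wi) i) (Measure.pi μ) :=
  integrable_of_measurable_of_abs_le ((M.measurable_pay i).comp measurable_update_left)
    fun _ => M.abs_pay_le _ i

lemma Mechanism.interimPay_mem_Icc (M : Mechanism T X H) (i : Fin n) (wi : T i) :
    M.interimPay μ i wi ∈ Set.Icc (-H) H := by
  have := norm_integral_le_of_norm_le_const (μ := Measure.pi μ)
    (Filter.Eventually.of_forall fun t =>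
      (Real.norm_eq_abs _).trans_le (M.abs_pay_le (Function.update t i wi) i))
  rw [Real.norm_eq_abs] at this
  simp only [probReal_univ, mul_one] at this
  exact abs_le.1 this

lemma Mechanism.integral_interimPay (M : Mechanism T X H) (i : Fin n) :
    ∫ wi, M.interimPay μ i wi ∂(μ i) = ∫ t, M.pay t i ∂(Measure.pi μ) := by
  rw [← integral_integral_update μ i (M.measurable_pay i) fun t => M.abs_pay_le t i]
  unfold Mechanism.interimPay
  rw [integral_integral_swap]
  exact integrable_of_measurable_of_abs_le ((M.measurable_pay i).comp
    (measurable_update'.comp (measurable_snd.prodMk measurable_fst)))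
    fun z => M.abs_pay_le (Function.update z.2 i z.1) i

lemma Mechanism.rev_pi (M : Mechanism T X H) :
    M.rev (Measure.pi μ) = ∑ i, ∫ wi, M.interimPay μ i wi ∂(μ i) := by
  unfold Mechanism.rev
  rw [integral_finsetSum _ fun i _ => integrable_of_measurable_of_abs_le (M.measurable_pay i)
    fun t => M.abs_pay_le t i]
  simp only [M.integral_interimPay μ]

lemma Mechanism.interimPay_le_interimValue (M : Mechanism T X H) (hM : M.IsExPostIR E)
    (i : Fin n) (ti : T i) : M.interimPay μ i ti ≤ E.interimValue μ M.alloc i ti ti := by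
  have := M.isMarkovKernel_alloc
  refine integral_mono (M.integrable_pay_update μ i ti)
    (E.integrable_allocValue_update μ M.alloc i ti ti) fun t => ?_
  have h := hM i (Function.update t i ti)
  rw [Function.update_self] at h
  exact sub_nonneg.1 h

lemma Mechanism.measurable_utilityDiff (M : Mechanism T X H) (i : Fin n) (ti wi : T i) :
    Measurable fun t => M.utilityDiff E i ti wi t := by
  have := M.isMarkovKernel_alloc
  have h : ∀ w : T i, Measurable fun t : ∀ i, T i => M.utility E i ti (Function.update t i w) :=
    fun w => ((E.measurable_allocValue_right M.alloc i ti).sub (M.measurable_pay i)).comp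
      measurable_update_left
  exact (h ti).sub (h wi)

lemma Mechanism.integral_utilityDiff (M : Mechanism T X H) (i : Fin n) (ti wi : T i) :
    ∫ t, M.utilityDiff E i ti wi t ∂(Measure.pi μ)
      = (E.interimValue μ M.alloc i ti ti - M.interimPay μ i ti)
        - (E.interimValue μ M.alloc i ti wi - M.interimPay μ i wi) := by
  have := M.isMarkovKernel_alloc
  have i1 := fun w => E.integrable_allocValue_update μ M.alloc i ti w
  have i2 := fun w => M.integrable_pay_update μ i w
  have i3 : ∀ w, Integrable (fun t => E.allocValue M.alloc i ti (Function.update t i w)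
      - M.pay (Function.update t i w) i) (Measure.pi μ) := fun w => (i1 w).sub (i2 w)
  unfold Environment.interimValue Mechanism.interimPay
  rw [← integral_sub (i1 ti) (i2 ti), ← integral_sub (i1 wi) (i2 wi),
    ← integral_sub (i3 ti) (i3 wi)]
  rfl

end InterimPayment

section Conditional

variable [∀ i, StandardBorelSpace (T i)] [∀ i, Nonempty (T i)]

omit [∀ i, StandardBorelSpace (T i)] [∀ i, Nonempty (T i)] in
lemma map_eval_pi (i : Fin n) : (Measure.pi μ).map (fun t => t i) = μ i :=
  (measurePreserving_eval μ i).map_eq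

/-- Under a product measure, conditioning on the coordinate `i` fixes this coordinate and leaves the
distribution of the others unchanged. -/
lemma condDistrib_pi (i : Fin n) :
    ∀ᵐ ti ∂(μ i), condDistrib (fun t : ∀ i, T i => t) (fun t => t i) (Measure.pi μ) ti
      = (Measure.pi μ).map fun t => Function.update t i ti := by
  have hu : Measurable fun z : T i × (∀ i, T i) => Function.update z.2 i z.1 :=
    measurable_update'.comp (measurable_snd.prodMk measurable_fst)
  let κ : Kernel (T i) (∀ i, T i) :=
    ((Kernel.id : Kernel (T i) (T i)) ×ₖ Kernel.const (T i) (Measure.pi μ)).map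
      fun z => Function.update z.2 i z.1
  have hκM : IsMarkovKernel κ := Kernel.IsMarkovKernel.map _ hu
  have hκ : ∀ ti, κ ti = (Measure.pi μ).map fun t => Function.update t i ti := by
    intro ti
    simp only [κ]
    rw [Kernel.map_apply _ hu, Kernel.prod_apply, Kernel.id_apply, Kernel.const_apply,
      Measure.dirac_prod, Measure.map_map hu measurable_prodMk_left]
    rfl
  have h := condDistrib_ae_eq_of_measure_eq_compProd (μ := Measure.pi μ)
    (X := fun t : ∀ i, T i => t i) (Y := fun t : ∀ i, T i => t) measurable_id.aemeasurable
    (κ := κ) ?_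
  · rw [map_eval_pi] at h
    filter_upwards [h] with ti hti
    rw [hti, hκ]
  · rw [map_eval_pi]
    ext s hs
    have hm : Measurable fun t : ∀ i, T i => (t i, t) :=
      (measurable_pi_apply i).prodMk measurable_id
    rw [Measure.compProd_apply hs, Measure.map_apply hm hs,
      ← (measurePreserving_update μ i).measure_preimage (hm hs).nullMeasurableSet,
      Measure.prod_apply_symm (measurable_update' (hm hs))]
    refine lintegral_congr fun ti => ?_
    rw [hκ, Measure.map_apply measurable_update_left (measurable_prodMk_left hs)]
    congr 1
    ext t
    simp

lemma Mechanism.interimDiff_pi (M : Mechanism T X H) (i : Fin n) :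
    ∀ᵐ ti ∂(μ i), ∀ wi, M.interimDiff E (Measure.pi μ) i ti wi
      = (E.interimValue μ M.alloc i ti ti - M.interimPay μ i ti)
        - (E.interimValue μ M.alloc i ti wi - M.interimPay μ i wi) := by
  filter_upwards [condDistrib_pi μ i] with ti hti wi
  unfold Mechanism.interimDiff
  rw [hti, integral_map measurable_update_left.aemeasurable
    (M.measurable_utilityDiff E i ti wi).aestronglyMeasurable,
    ← M.integral_utilityDiff μ E]
  simp only [Mechanism.utilityDiff, Function.update_idem]

/-- For independent types, only the interim payments matter for incentives: interim payments that
are individually rational on average can be charged in an ex-post individually rational way, in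
proportion to the realized values. -/
theorem Environment.exists_mechanism_of_interimPay (x : Kernel (∀ i, T i) X) [IsMarkovKernel x]
    {Q : ∀ i, T i → ℝ} (hQ : ∀ i, Measurable (Q i)) (hQH : ∀ i t, Q i t ∈ Set.Icc (-H) H)
    (hIC : ∀ i t w, E.interimValue μ x i t w - Q i w ≤ E.interimValue μ x i t t - Q i t)
    (hIR : ∀ i t, Q i t ≤ E.interimValue μ x i t t) :
    ∃ M : Mechanism T X H, M.IsExPostIR E ∧ M.IsBIC E (Measure.pi μ) ∧
      M.rev (Measure.pi μ) = ∑ i, ∫ t, Q i t ∂(μ i) := by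
  classical
  let W : ∀ i, T i → ℝ := fun i t => E.interimValue μ x i t t
  have hW : ∀ i, Measurable (W i) := fun i =>
    (E.measurable_interimValue μ x i).comp (measurable_id.prodMk measurable_id)
  -- a subsidy is paid as it is; `W i (t i)` does not vanish when the interim payment is positive
  let pay : (∀ i, T i) → Fin n → ℝ := fun t i =>
    if 0 < Q i (t i) then Q i (t i) / W i (t i) * E.allocValue x i (t i) t else Q i (t i)
  have hpos : ∀ t i, 0 < Q i (t i) → pay t i ∈ Set.Icc 0 (E.allocValue x i (t i) t) := by
    intro t i h
    have h1 := (E.allocValue_mem_Icc x i (t i) t).1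
    have h2 : Q i (t i) / W i (t i) ≤ 1 := div_le_one_of_le₀ (hIR i _) (h.le.trans (hIR i _))
    simp only [pay, if_pos h]
    exact ⟨mul_nonneg (div_nonneg h.le (h.le.trans (hIR i _))) h1, mul_le_of_le_one_left h1 h2⟩
  have hav : ∀ i, Measurable fun t : ∀ i, T i => E.allocValue x i (t i) t := fun i =>
    (E.measurable_allocValue x i).comp ((measurable_pi_apply i).prodMk measurable_id)
  let M : Mechanism T X H :=
    { alloc := x
      isMarkovKernel_alloc := inferInstance
      pay := pay
      measurable_pay := fun i => by
        have h1 := (hQ i).comp (measurable_pi_apply i)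
        exact Measurable.ite (measurableSet_lt measurable_const h1)
          ((h1.div ((hW i).comp (measurable_pi_apply i))).mul (hav i)) h1
      pay_mem := fun t i => by
        have hH := E.allocValue_mem_Icc x i (t i) t
        by_cases h : 0 < Q i (t i)
        · have := hpos t i h
          exact ⟨by linarith [this.1, hH.1, hH.2], this.2.trans hH.2⟩
        · simp only [pay, if_neg h]
          exact hQH i _ }
  have hMpay : ∀ i w, M.interimPay μ i w = Q i w := by
    intro i w
    change ∫ t, pay (Function.update t i w) i ∂(Measure.pi μ) = Q i w
    by_cases h : 0 < Q i w
    · simp only [pay, Function.update_self, if_pos h]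
      rw [integral_const_mul]
      exact div_mul_cancel₀ _ (h.trans_le (hIR i w)).ne'
    · simp only [pay, Function.update_self, if_neg h]
      simp
  refine ⟨M, fun i t => ?_, fun i => ?_, ?_⟩
  · refine sub_nonneg.2 ?_
    change pay t i ≤ E.allocValue x i (t i) t
    by_cases h : 0 < Q i (t i)
    · exact (hpos t i h).2
    · simp only [pay, if_neg h]
      exact (not_lt.1 h).trans (E.allocValue_mem_Icc x i (t i) t).1
  · rw [map_eval_pi]
    filter_upwards [M.interimDiff_pi μ E i] with ti hti wi
    rw [hti, hMpay, hMpay]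
    exact sub_nonneg.2 (hIC i ti wi)
  · rw [M.rev_pi μ]
    simp only [hMpay]

/-- **From approximate to exact incentive compatibility.** For independent types, an ex-post
individually rational mechanism that is approximately incentive compatible can be replaced by one
that is ex-post individually rational and incentive compatible, at a small loss of revenue. -/
theorem Mechanism.exists_isBIC_of_isApproxBIC (M : Mechanism T X H) (hH : 0 < H)
    (hsep : E.SeparableValuations) (hIR : M.IsExPostIR E) {ε q : ℝ} (hε : 0 ≤ ε)
    (hM : M.IsApproxBIC E (Measure.pi μ) ε q) {η : ℝ} (hη0 : 0 < η) (hη1 : η ≤ 1) {κ : ℝ}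
    (hκ : 0 < κ) :
    ∃ M' : Mechanism T X H, M'.IsExPostIR E ∧ M'.IsBIC E (Measure.pi μ) ∧
      M.rev (Measure.pi μ) - n * (η * H + (ε + 2 * H * q + κ) / η) ≤ M'.rev (Measure.pi μ) := by
  have := M.isMarkovKernel_alloc
  -- the bad set need not be measurable, so it is replaced by its measurable hull below
  let bad : ∀ i, Set (T i) := fun i =>
    {ti | ¬ ∀ wi : T i, -ε ≤ M.interimDiff E (Measure.pi μ) i ti wi} ∪
    {ti | ¬ ∀ wi, M.interimDiff E (Measure.pi μ) i ti wi
      = (E.interimValue μ M.alloc i ti ti - M.interimPay μ i ti)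
        - (E.interimValue μ M.alloc i ti wi - M.interimPay μ i wi)}
  have hbad : ∀ i, (μ i).real (bad i) ≤ q := by
    intro i
    have h1 := hM i
    rw [map_eval_pi] at h1
    have h2 := ae_iff.1 (M.interimDiff_pi μ E i)
    refine (measureReal_union_le _ _).trans ?_
    have h3 : (μ i).real {ti | ¬ ∀ wi, M.interimDiff E (Measure.pi μ) i ti wi
      = (E.interimValue μ M.alloc i ti ti - M.interimPay μ i ti)
        - (E.interimValue μ M.alloc i ti wi - M.interimPay μ i wi)} = 0 := by
      rw [measureReal_def, h2, ENNReal.toReal_zero]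
    rw [h3, add_zero]
    exact h1
  obtain ⟨x, hx, Q, -, hQ⟩ := E.exists_incentive_allocation μ hH hsep M.alloc
    (P := fun i => M.interimPay μ i) (M.measurable_interimPay μ) (M.interimPay_mem_Icc μ)
    (M.interimPay_le_interimValue μ E hIR) hε
    (G := fun i => (toMeasurable (μ i) (bad i))ᶜ) (q := q)
    (fun i => (measurableSet_toMeasurable _ _).compl)
    (fun i => by
      rw [compl_compl, measureReal_def, measure_toMeasurable]
      exact hbad i)
    (fun i t ht s => by
      have h1 : t ∉ bad i := fun h => ht (subset_toMeasurable _ _ h)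
      simp only [bad, Set.mem_union, Set.mem_ofPred_eq, not_or, not_not] at h1
      have h2 := h1.1 s
      rw [h1.2 s] at h2
      linarith)
    hη0 hη1 hκ Finset.univ
  obtain ⟨M', h1, h2, h3⟩ := E.exists_mechanism_of_interimPay μ x
    (fun i => (hQ i (Finset.mem_univ i)).1) (fun i => (hQ i (Finset.mem_univ i)).2.1)
    (fun i => (hQ i (Finset.mem_univ i)).2.2.1) (fun i => (hQ i (Finset.mem_univ i)).2.2.2.1)
  refine ⟨M', h1, h2, ?_⟩
  rw [h3, M.rev_pi μ]
  have h4 := Finset.sum_le_sum fun i (hi : i ∈ Finset.univ) => (hQ i hi).2.2.2.2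
  simp only [Finset.sum_sub_distrib, Finset.sum_const, Finset.card_univ, Fintype.card_fin,
    nsmul_eq_mul] at h4
  linarith

end Conditional

end IncentiveMechanism

/-! ### Total variation distance and conditional distributions -/

section TotalVariation

variable {Ω : Type*} [MeasurableSpace Ω] (P Q : Measure Ω) [IsProbabilityMeasure P]
  [IsProbabilityMeasure Q]

lemma abs_measureReal_sub_le_one (S : Set Ω) : |P.real S - Q.real S| ≤ 1 := by
  have h1 := measureReal_le_one (μ := P) (s := S)
  have h2 := measureReal_le_one (μ := Q) (s := S)
  have h3 : 0 ≤ P.real S := measureReal_nonneg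
  have h4 : 0 ≤ Q.real S := measureReal_nonneg
  rw [abs_le]; constructor <;> linarith

lemma abs_measureReal_sub_le_tvDist {S : Set Ω} (hS : MeasurableSet S) :
    |P.real S - Q.real S| ≤ tvDist P Q :=
  le_ciSup (f := fun E : {E : Set Ω // MeasurableSet E} => |P.real E.1 - Q.real E.1|)
    ⟨1, by rintro _ ⟨E, rfl⟩; exact abs_measureReal_sub_le_one P Q E.1⟩ ⟨S, hS⟩

lemma tvDist_nonneg : 0 ≤ tvDist P Q :=
  (abs_nonneg _).trans (abs_measureReal_sub_le_tvDist P Q MeasurableSet.empty)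

lemma tvDist_le_one : tvDist P Q ≤ 1 :=
  haveI : Nonempty {E : Set Ω // MeasurableSet E} := ⟨⟨∅, MeasurableSet.empty⟩⟩
  ciSup_le fun E => abs_measureReal_sub_le_one P Q E.1

omit [IsProbabilityMeasure P] [IsProbabilityMeasure Q] in
lemma tvDist_comm : tvDist P Q = tvDist Q P := by
  unfold tvDist
  simp only [abs_sub_comm]

lemma eq_of_tvDist_eq_zero (h : tvDist P Q = 0) : P = Q := by
  ext S hS
  have h1 := abs_measureReal_sub_le_tvDist P Q hS
  rw [h] at h1
  have h2 := sub_eq_zero.1 (abs_nonpos_iff.1 h1)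
  exact (measureReal_eq_measureReal_iff).1 h2

/-- A finite measure dominated by another one has a density with values in `[0, 1]`. -/
lemma exists_density_of_le {P ρ : Measure Ω} [IsFiniteMeasure P] [IsFiniteMeasure ρ] (h : P ≤ ρ) :
    ∃ a : Ω → ℝ, Measurable a ∧ (∀ ω, a ω ∈ Set.Icc 0 1) ∧
      P = ρ.withDensity fun ω => ENNReal.ofReal (a ω) := by
  refine ⟨fun ω => min (P.rnDeriv ρ ω).toReal 1,
    (Measure.measurable_rnDeriv P ρ).ennreal_toReal.min measurable_const,
    fun ω => ⟨le_min ENNReal.toReal_nonneg zero_le_one, min_le_right _ _⟩, ?_⟩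
  conv_lhs => rw [← Measure.withDensity_rnDeriv_eq P ρ (Measure.absolutelyContinuous_of_le h)]
  refine withDensity_congr_ae ?_
  filter_upwards [Measure.rnDeriv_le_one_of_le h] with ω hω
  have h1 : P.rnDeriv ρ ω ≤ 1 := hω
  have h2 : (P.rnDeriv ρ ω).toReal ≤ 1 := ENNReal.toReal_le_of_le_ofReal zero_le_one (by simpa)
  rw [min_eq_left h2, ENNReal.ofReal_toReal (ne_top_of_le_ne_top ENNReal.one_ne_top h1)]

lemma integral_withDensity_ofReal {ρ : Measure Ω} {a : Ω → ℝ} (ha : Measurable a)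
    (ha0 : ∀ ω, 0 ≤ a ω) (f : Ω → ℝ) :
    ∫ ω, f ω ∂(ρ.withDensity fun ω => ENNReal.ofReal (a ω)) = ∫ ω, a ω * f ω ∂ρ := by
  rw [integral_withDensity_eq_integral_toReal_smul ha.ennreal_ofReal
    (Filter.Eventually.of_forall fun _ => ENNReal.ofReal_lt_top)]
  simp only [ENNReal.toReal_ofReal (ha0 _), smul_eq_mul]

/-- Two probability measures have densities with respect to a common measure whose `L¹` distance is
at most twice the total variation distance. -/
lemma exists_densities_of_tvDist : ∃ (ρ : Measure Ω) (_ : IsFiniteMeasure ρ) (a b : Ω → ℝ),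
    Measurable a ∧ Measurable b ∧ (∀ ω, a ω ∈ Set.Icc 0 1) ∧ (∀ ω, b ω ∈ Set.Icc 0 1) ∧
    P = ρ.withDensity (fun ω => ENNReal.ofReal (a ω)) ∧
    Q = ρ.withDensity (fun ω => ENNReal.ofReal (b ω)) ∧
    ∫ ω, |a ω - b ω| ∂ρ ≤ 2 * tvDist P Q := by
  obtain ⟨a, ha, ha1, hP⟩ := exists_density_of_le (Measure.le_add_right le_rfl : P ≤ P + Q)
  obtain ⟨b, hb, hb1, hQ⟩ := exists_density_of_le (Measure.le_add_left le_rfl : Q ≤ P + Q)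
  refine ⟨P + Q, inferInstance, a, b, ha, hb, ha1, hb1, hP, hQ, ?_⟩
  have hfin : IsFiniteMeasure (P + Q) := inferInstance
  generalize P + Q = ρ at hP hQ hfin ⊢
  have key : ∀ {P : Measure Ω} {a : Ω → ℝ}, Measurable a → (∀ ω, a ω ∈ Set.Icc 0 1) →
      P = ρ.withDensity (fun ω => ENNReal.ofReal (a ω)) → ∀ {S : Set Ω}, MeasurableSet S →
      ∫ ω in S, a ω ∂ρ = P.real S := by
    intro P a ha ha1 hP S hS
    rw [← integral_indicator_one hS, hP, integral_withDensity_ofReal ha fun ω => (ha1 ω).1,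
      ← integral_indicator hS]
    congr 1
    ext ω
    by_cases h : ω ∈ S <;> simp [h]
  have hint : ∀ {a : Ω → ℝ}, Measurable a → (∀ ω, a ω ∈ Set.Icc 0 1) → Integrable a ρ :=
    fun {a} ha ha1 => integrable_of_measurable_of_abs_le ha (C := 1) fun ω =>
      abs_le.2 ⟨by linarith [(ha1 ω).1], (ha1 ω).2⟩
  have hai := hint ha ha1
  have hbi := hint hb hb1
  have hS : MeasurableSet {ω | b ω ≤ a ω} := measurableSet_le hb ha
  rw [← integral_add_compl (f := fun ω => |a ω - b ω|) hS (hai.sub hbi).abs]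
  have e1 : ∫ ω in {ω | b ω ≤ a ω}, |a ω - b ω| ∂ρ ≤ tvDist P Q := by
    have : ∫ ω in {ω | b ω ≤ a ω}, |a ω - b ω| ∂ρ = ∫ ω in {ω | b ω ≤ a ω}, (a ω - b ω) ∂ρ :=
      setIntegral_congr_fun hS fun ω hω => abs_of_nonneg (sub_nonneg.2 hω)
    rw [this, integral_sub hai.integrableOn hbi.integrableOn, key ha ha1 hP hS, key hb hb1 hQ hS]
    exact (le_abs_self _).trans (abs_measureReal_sub_le_tvDist P Q hS)
  have e2 : ∫ ω in {ω | b ω ≤ a ω}ᶜ, |a ω - b ω| ∂ρ ≤ tvDist P Q := by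
    have : ∫ ω in {ω | b ω ≤ a ω}ᶜ, |a ω - b ω| ∂ρ
        = ∫ ω in {ω | b ω ≤ a ω}ᶜ, (b ω - a ω) ∂ρ :=
      setIntegral_congr_fun hS.compl fun ω hω => by
        have h : a ω < b ω := not_le.1 hω
        change |a ω - b ω| = b ω - a ω
        rw [abs_of_neg (sub_neg.2 h), neg_sub]
    rw [this, integral_sub hbi.integrableOn hai.integrableOn, key ha ha1 hP hS.compl,
      key hb hb1 hQ hS.compl]
    refine le_trans (le_abs_self _) ?_
    rw [abs_sub_comm]
    exact abs_measureReal_sub_le_tvDist P Q hS.compl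
  linarith

lemma abs_integral_sub_le_tvDist {f : Ω → ℝ} (hf : Measurable f) {C : ℝ} (hC : ∀ ω, |f ω| ≤ C) :
    |∫ ω, f ω ∂P - ∫ ω, f ω ∂Q| ≤ 2 * C * tvDist P Q := by
  obtain ⟨ρ, hρ, a, b, ha, hb, ha1, hb1, hP, hQ, hab⟩ := exists_densities_of_tvDist P Q
  obtain ⟨ω₀⟩ : Nonempty Ω := nonempty_of_isProbabilityMeasure P
  have hC0 : 0 ≤ C := (abs_nonneg _).trans (hC ω₀)
  have key : ∀ {a : Ω → ℝ}, Measurable a → (∀ ω, a ω ∈ Set.Icc 0 1) →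
      Integrable (fun ω => a ω * f ω) ρ := fun {a} ha ha1 =>
    integrable_of_measurable_of_abs_le (ha.mul hf) (C := 1 * C) fun ω => by
      rw [abs_mul]
      exact mul_le_mul (abs_le.2 ⟨by linarith [(ha1 ω).1], (ha1 ω).2⟩) (hC ω) (abs_nonneg _)
        zero_le_one
  have e1 : ∫ ω, f ω ∂P = ∫ ω, a ω * f ω ∂ρ := by
    rw [hP, integral_withDensity_ofReal ha fun ω => (ha1 ω).1]
  have e2 : ∫ ω, f ω ∂Q = ∫ ω, b ω * f ω ∂ρ := by
    rw [hQ, integral_withDensity_ofReal hb fun ω => (hb1 ω).1]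
  have habint : Integrable (fun ω => |a ω - b ω|) ρ :=
    integrable_of_measurable_of_abs_le (ha.sub hb).abs (C := 1) fun ω => by
      rw [abs_abs]
      exact abs_le.2 ⟨by linarith [(ha1 ω).1, (hb1 ω).2], by linarith [(ha1 ω).2, (hb1 ω).1]⟩
  rw [e1, e2, ← integral_sub (key ha ha1) (key hb hb1)]
  calc |∫ ω, (a ω * f ω - b ω * f ω) ∂ρ| ≤ ∫ ω, |a ω * f ω - b ω * f ω| ∂ρ :=
        abs_integral_le_integral_abs
    _ ≤ ∫ ω, C * |a ω - b ω| ∂ρ := by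
        refine integral_mono ((key ha ha1).sub (key hb hb1)).abs (habint.const_mul C) fun ω => ?_
        change |a ω * f ω - b ω * f ω| ≤ C * |a ω - b ω|
        rw [← sub_mul, abs_mul, mul_comm]
        exact mul_le_mul_of_nonneg_right (hC ω) (abs_nonneg _)
    _ ≤ 2 * C * tvDist P Q := by
        rw [integral_const_mul]
        nlinarith

end TotalVariation

section Conditioning

variable {Ω S : Type*} [MeasurableSpace Ω] [StandardBorelSpace Ω] [Nonempty Ω] [MeasurableSpace S]
  [MeasurableSpace.CountableOrCountablyGenerated S Ω]

/-- Bayes' rule for densities. If `P` has density `a` with respect to `ρ`, then the conditional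
distribution under `P` is obtained from the one under `ρ` by weighting with `a` and normalizing; the
normalizing factor is the density of the marginals. -/
lemma integral_condDistrib_withDensity {ρ P : Measure Ω} [IsFiniteMeasure ρ] [IsFiniteMeasure P]
    {a : Ω → ℝ} (ha : Measurable a) (ha1 : ∀ ω, a ω ∈ Set.Icc 0 1)
    (hP : P = ρ.withDensity fun ω => ENNReal.ofReal (a ω)) {X : Ω → S} (hX : Measurable X) :
    P.map X = (ρ.map X).withDensity
        (fun s => ENNReal.ofReal (∫ ω, a ω ∂(condDistrib (fun ω => ω) X ρ s))) ∧
      ∀ᵐ s ∂(ρ.map X), ∀ f : Ω → ℝ,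
        (∫ ω, a ω ∂(condDistrib (fun ω => ω) X ρ s)) * ∫ ω, f ω ∂(condDistrib (fun ω => ω) X P s)
          = ∫ ω, a ω * f ω ∂(condDistrib (fun ω => ω) X ρ s) := by
  set K := condDistrib (fun ω => ω) X ρ with hK
  set L := condDistrib (fun ω => ω) X P with hL
  let A : S → ℝ := fun s => ∫ ω, a ω ∂(K s)
  have hAm : Measurable A := ha.stronglyMeasurable.integral_kernel.measurable
  have hA0 : ∀ s, 0 ≤ A s := fun s => integral_nonneg fun ω => (ha1 ω).1
  have haint : ∀ s, Integrable a (K s) := fun s =>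
    integrable_of_measurable_of_abs_le ha (C := 1) fun ω =>
      abs_le.2 ⟨by linarith [(ha1 ω).1], (ha1 ω).2⟩
  have hAl : ∀ s, ∫⁻ ω, ENNReal.ofReal (a ω) ∂(K s) = ENNReal.ofReal (A s) := fun s =>
    (ofReal_integral_eq_lintegral_ofReal (haint s)
      (Filter.Eventually.of_forall fun ω => (ha1 ω).1)).symm
  have hA1 : ∀ s, A s ≤ 1 := fun s => by
    have := integral_mono (haint s) (integrable_const (1 : ℝ)) fun ω => (ha1 ω).2
    simpa using this
  have hρK : (ρ.map X) ⊗ₘ K = ρ.map fun ω => (X ω, ω) :=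
    compProd_map_condDistrib measurable_id.aemeasurable
  have hPL : (P.map X) ⊗ₘ L = P.map fun ω => (X ω, ω) :=
    compProd_map_condDistrib measurable_id.aemeasurable
  have hXm : Measurable fun ω => (X ω, ω) := hX.prodMk measurable_id
  have hma : Measurable fun z : S × Ω => ENNReal.ofReal (a z.2) :=
    (ha.comp measurable_snd).ennreal_ofReal
  have hmarg : P.map X = (ρ.map X).withDensity fun s => ENNReal.ofReal (A s) := by
    ext U hU
    rw [withDensity_apply _ hU, Measure.map_apply hX hU, hP, withDensity_apply _ (hX hU)]
    have h1 : ∫⁻ ω in X ⁻¹' U, ENNReal.ofReal (a ω) ∂ρ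
        = ∫⁻ z in U ×ˢ Set.univ, ENNReal.ofReal (a z.2) ∂((ρ.map X) ⊗ₘ K) := by
      rw [hρK, setLIntegral_map (hU.prod MeasurableSet.univ) hma hXm]
      congr 2
      ext ω
      simp
    rw [h1, Measure.setLIntegral_compProd hma hU MeasurableSet.univ]
    simp only [Measure.restrict_univ, hAl]
  refine ⟨hmarg, ?_⟩
  let κ₁ : Kernel S Ω := L.withDensity fun s _ => ENNReal.ofReal (A s)
  let κ₂ : Kernel S Ω := K.withDensity fun _ ω => ENNReal.ofReal (a ω)
  have m1 : Measurable (Function.uncurry fun (s : S) (_ : Ω) => ENNReal.ofReal (A s)) :=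
    (hAm.comp measurable_fst).ennreal_ofReal
  have m2 : Measurable (Function.uncurry fun (_ : S) (ω : Ω) => ENNReal.ofReal (a ω)) :=
    (ha.comp measurable_snd).ennreal_ofReal
  have f1 : IsFiniteKernel κ₁ := Kernel.isFiniteKernel_withDensity_of_bounded (B := 1) L
    ENNReal.one_ne_top fun s _ => by simpa using hA1 s
  have f2 : IsFiniteKernel κ₂ := Kernel.isFiniteKernel_withDensity_of_bounded (B := 1) K
    ENNReal.one_ne_top fun _ ω => by simpa using (ha1 ω).2
  -- both kernels disintegrate the joint distribution of `X ω` and `ω` under `P`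
  have heq : (ρ.map X) ⊗ₘ κ₁ = (ρ.map X) ⊗ₘ κ₂ := by
    have e1 : (ρ.map X) ⊗ₘ κ₁ = P.map fun ω => (X ω, ω) := by
      rw [← hPL, hmarg]
      ext U hU
      rw [Measure.compProd_apply hU, Measure.compProd_apply hU,
        lintegral_withDensity_eq_lintegral_mul _ hAm.ennreal_ofReal
          (Kernel.measurable_kernel_prodMk_left hU)]
      refine lintegral_congr fun s => ?_
      simp only [κ₁, Pi.mul_apply]
      rw [Kernel.withDensity_apply' _ m1, setLIntegral_const]
    have e2 : (ρ.map X) ⊗ₘ κ₂ = P.map fun ω => (X ω, ω) := by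
      rw [Measure.compProd_withDensity m2, hρK, hP]
      ext U hU
      rw [withDensity_apply _ hU, Measure.map_apply hXm hU, withDensity_apply _ (hXm hU),
        setLIntegral_map hU hma hXm]
    rw [e1, e2]
  filter_upwards [Kernel.ae_eq_of_compProd_eq heq] with s hs f
  have h1 : ∫ ω, f ω ∂(κ₁ s) = A s * ∫ ω, f ω ∂(L s) := by
    simp only [κ₁]
    rw [Kernel.withDensity_apply _ m1, integral_withDensity_ofReal measurable_const
      (fun _ => hA0 s), integral_const_mul]
  have h2 : ∫ ω, f ω ∂(κ₂ s) = ∫ ω, a ω * f ω ∂(K s) := by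
    simp only [κ₂]
    rw [Kernel.withDensity_apply _ m2, integral_withDensity_ofReal ha fun ω => (ha1 ω).1]
  rw [← h2, ← hs, h1]

end Conditioning

/-! ### Robustness of incentives and of the optimal revenue -/

section Robustness

variable {n : ℕ} {T : Fin n → Type u} [∀ i, MeasurableSpace (T i)]
  {X : Type v} [MeasurableSpace X] {H : ℝ} (E : Environment T X H)

lemma Mechanism.abs_utilityDiff_le (M : Mechanism T X H) (i : Fin n) (ti wi : T i)
    (t : ∀ i, T i) : |M.utilityDiff E i ti wi t| ≤ 3 * H := by
  have := M.isMarkovKernel_alloc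
  have h : ∀ b : ∀ i, T i, M.utility E i ti b ∈ Set.Icc (-H) (2 * H) := fun b => by
    have h1 := E.allocValue_mem_Icc M.alloc i ti b
    have h2 := M.pay_mem b i
    have h3 : M.utility E i ti b = E.allocValue M.alloc i ti b - M.pay b i := rfl
    rw [h3]
    constructor <;> linarith [h1.1, h1.2, h2.1, h2.2]
  have h1 := h (Function.update t i ti)
  have h2 := h (Function.update t i wi)
  unfold Mechanism.utilityDiff
  rw [abs_le]
  constructor <;> linarith [h1.1, h1.2, h2.1, h2.2]

lemma Mechanism.abs_sum_pay_le (M : Mechanism T X H) (t : ∀ i, T i) :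
    |∑ i, M.pay t i| ≤ n * H :=
  (Finset.abs_sum_le_sum_abs _ _).trans <| by
    simpa using Finset.sum_le_sum fun i (_ : i ∈ Finset.univ) => M.abs_pay_le t i

lemma Mechanism.measurable_sum_pay (M : Mechanism T X H) : Measurable fun t => ∑ i, M.pay t i :=
  Finset.measurable_fun_sum _ fun i _ => M.measurable_pay i

lemma Mechanism.rev_le (M : Mechanism T X H) (P : Measure (∀ i, T i)) [IsProbabilityMeasure P] :
    M.rev P ≤ n * H := by
  have := norm_integral_le_of_norm_le_const (μ := P)
    (Filter.Eventually.of_forall fun t => (Real.norm_eq_abs _).trans_le (M.abs_sum_pay_le t))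
  rw [Real.norm_eq_abs] at this
  simp only [probReal_univ, mul_one] at this
  exact (le_abs_self _).trans this

lemma Mechanism.abs_rev_sub_rev_le (M : Mechanism T X H) (P Q : Measure (∀ i, T i))
    [IsProbabilityMeasure P] [IsProbabilityMeasure Q] :
    |M.rev P - M.rev Q| ≤ 2 * (n * H) * tvDist P Q :=
  abs_integral_sub_le_tvDist P Q M.measurable_sum_pay M.abs_sum_pay_le

variable [∀ i, StandardBorelSpace (T i)] [∀ i, Nonempty (T i)]

/-- **Robustness of incentive compatibility.** The interim inequality under `P` transfers to `Q` up
to the `L¹` distance of the conditional densities; Markov's inequality bounds the mass of the types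
for which this distance is large. -/
theorem Mechanism.IsBIC.isApproxBIC_of_tvDist_le {E : Environment T X H} {M : Mechanism T X H}
    (hH : 0 < H) {P Q : Measure (∀ i, T i)} [IsProbabilityMeasure P] [IsProbabilityMeasure Q]
    (hM : M.IsBIC E P) {δ : ℝ} (hδ : tvDist P Q ≤ δ) {q : ℝ} (hq : 0 < q) :
    M.IsApproxBIC E Q (8 * H * δ / q) q := by
  intro i
  -- when `δ = 0` there is no tolerance for Markov's inequality, but then `P = Q`
  rcases eq_or_lt_of_le ((tvDist_nonneg P Q).trans hδ) with h0 | hδ0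
  · have hPQ : P = Q := eq_of_tvDist_eq_zero P Q (le_antisymm (hδ.trans h0.symm.le)
      (tvDist_nonneg P Q))
    subst hPQ
    rw [← h0]
    simp only [mul_zero, zero_div, neg_zero]
    rw [measureReal_def, ae_iff.1 (hM i), ENNReal.toReal_zero]
    exact hq.le
  obtain ⟨ρ, hρ, a, b, ha, hb, ha1, hb1, hP, hQ, hab⟩ := exists_densities_of_tvDist P Q
  have hXm : Measurable fun t : ∀ i, T i => t i := measurable_pi_apply i
  obtain ⟨hPm, hPK⟩ := integral_condDistrib_withDensity ha ha1 hP hXm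
  obtain ⟨hQm, hQK⟩ := integral_condDistrib_withDensity hb hb1 hQ hXm
  have hρK : (ρ.map fun t => t i) ⊗ₘ condDistrib (fun t : ∀ i, T i => t) (fun t => t i) ρ =
      ρ.map fun t => (t i, t) := compProd_map_condDistrib measurable_id.aemeasurable
  have hBIC := hM i
  have hKM : IsMarkovKernel (condDistrib (fun t : ∀ i, T i => t) (fun t => t i) ρ) := inferInstance
  unfold Mechanism.interimDiff at hBIC ⊢
  generalize condDistrib (fun t : ∀ i, T i => t) (fun t => t i) ρ = K at hPm hPK hQm hQK hρK hKM
  generalize condDistrib (fun t : ∀ i, T i => t) (fun t => t i) P = KP at hPK hBIC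
  generalize condDistrib (fun t : ∀ i, T i => t) (fun t => t i) Q = KQ at hQK ⊢
  set ρi := ρ.map fun t => t i with hρi
  have hdm : Measurable fun t => |a t - b t| := (ha.sub hb).abs
  have hd1 : ∀ t, |a t - b t| ≤ 1 := fun t =>
    abs_le.2 ⟨by linarith [(ha1 t).1, (hb1 t).2], by linarith [(ha1 t).2, (hb1 t).1]⟩
  let A : T i → ℝ := fun s => ∫ t, a t ∂(K s)
  let B : T i → ℝ := fun s => ∫ t, b t ∂(K s)
  let θ : T i → ℝ := fun s => ∫ t, |a t - b t| ∂(K s)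
  have hA0 : ∀ s, 0 ≤ A s := fun s => integral_nonneg fun t => (ha1 t).1
  have hB0 : ∀ s, 0 ≤ B s := fun s => integral_nonneg fun t => (hb1 t).1
  have hAm : Measurable A := ha.stronglyMeasurable.integral_kernel.measurable
  have hBm : Measurable B := hb.stronglyMeasurable.integral_kernel.measurable
  have hθm : Measurable θ := hdm.stronglyMeasurable.integral_kernel.measurable
  have hB1 : ∀ s, |B s| ≤ 1 := fun s => by
    have := norm_integral_le_of_norm_le_const (μ := K s)
      (Filter.Eventually.of_forall fun t => (Real.norm_eq_abs (b t)).trans_le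
        (abs_le.2 ⟨by linarith [(hb1 t).1], (hb1 t).2⟩))
    simpa using this
  have hθ1 : ∀ s, |θ s| ≤ 1 := fun s => by
    have := norm_integral_le_of_norm_le_const (μ := K s)
      (Filter.Eventually.of_forall fun t => (Real.norm_eq_abs |a t - b t|).trans_le
        ((abs_abs _).trans_le (hd1 t)))
    simpa using this
  have hθ0 : ∀ s, 0 ≤ θ s := fun s => integral_nonneg fun t => abs_nonneg _
  have hθint : Integrable θ ρi := integrable_of_measurable_of_abs_le hθm hθ1
  have hBint : Integrable B ρi := integrable_of_measurable_of_abs_le hBm hB1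
  have hθ : ∫ s, θ s ∂ρi ≤ 2 * δ := by
    have h1 : ∫ z, |a z.2 - b z.2| ∂(ρi ⊗ₘ K) = ∫ s, θ s ∂ρi :=
      Measure.integral_compProd (f := fun z : T i × (∀ i, T i) => |a z.2 - b z.2|)
        (integrable_of_measurable_of_abs_le (hdm.comp measurable_snd) (C := 1) fun z =>
          (abs_abs _).trans_le (hd1 z.2))
    have h2 : ∫ z, |a z.2 - b z.2| ∂(ρ.map fun t => (t i, t)) = ∫ t, |a t - b t| ∂ρ :=
      integral_map (f := fun z : T i × (∀ i, T i) => |a z.2 - b z.2|)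
        (hXm.prodMk measurable_id).aemeasurable (hdm.comp measurable_snd).aestronglyMeasurable
    rw [← h1, hρK, h2]
    linarith
  rw [hPm] at hBIC
  rw [ae_withDensity_iff hAm.ennreal_ofReal] at hBIC
  have hmain : ∀ᵐ s ∂ρi, ∀ w : T i,
      -(3 * H * θ s) ≤ B s * ∫ t, M.utilityDiff E i s w t ∂(KQ s) := by
    filter_upwards [hBIC, hPK, hQK] with s h1 h2 h3 w
    have hfm := M.measurable_utilityDiff E i s w
    have hfb := M.abs_utilityDiff_le E i s w
    have hint : ∀ {c : (∀ i, T i) → ℝ}, Measurable c → (∀ t, c t ∈ Set.Icc 0 1) →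
        Integrable (fun t => c t * M.utilityDiff E i s w t) (K s) := fun {c} hc hc1 =>
      integrable_of_measurable_of_abs_le (hc.mul hfm) (C := 1 * (3 * H)) fun t => by
        rw [abs_mul]
        exact mul_le_mul (abs_le.2 ⟨by linarith [(hc1 t).1], (hc1 t).2⟩) (hfb t) (abs_nonneg _)
          zero_le_one
    have h4 : 0 ≤ ∫ t, a t * M.utilityDiff E i s w t ∂(K s) := by
      rw [← h2 fun t => M.utilityDiff E i s w t]
      rcases eq_or_lt_of_le (hA0 s) with hA | hA
      · rw [show ∫ t, a t ∂(K s) = 0 from hA.symm, zero_mul]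
      · exact mul_nonneg hA.le (h1 (by simpa using hA) w)
    have h5 : ∫ t, (a t * M.utilityDiff E i s w t - b t * M.utilityDiff E i s w t) ∂(K s)
        ≤ ∫ t, 3 * H * |a t - b t| ∂(K s) := by
      refine integral_mono ((hint ha ha1).sub (hint hb hb1))
        ((integrable_of_measurable_of_abs_le hdm (C := 1) fun t =>
          (abs_abs _).trans_le (hd1 t)).const_mul _) fun t => ?_
      change a t * M.utilityDiff E i s w t - b t * M.utilityDiff E i s w t ≤ 3 * H * |a t - b t|
      rw [← sub_mul]
      refine (le_abs_self _).trans ?_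
      rw [abs_mul, mul_comm]
      exact mul_le_mul_of_nonneg_right (hfb t) (abs_nonneg _)
    rw [integral_sub (hint ha ha1) (hint hb hb1), integral_const_mul] at h5
    have h6 := h3 fun t => M.utilityDiff E i s w t
    change B s * _ = _ at h6
    rw [h6]
    change _ ≤ 3 * H * θ s at h5
    linarith
  set ε := 8 * H * δ / q with hε
  have hε0 : 0 < ε := by positivity
  -- a measurable set that contains almost all types with a profitable misreport
  let bad : Set (T i) := {s | ε * B s < 3 * H * θ s}
  have hbadm : MeasurableSet bad := measurableSet_lt (hBm.const_mul _) (hθm.const_mul _)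
  have hsub : ∀ᵐ s ∂(Q.map fun t => t i),
      (¬ ∀ w : T i, -ε ≤ ∫ t, M.utilityDiff E i s w t ∂(KQ s)) → s ∈ bad := by
    rw [hQm, ae_withDensity_iff hBm.ennreal_ofReal]
    filter_upwards [hmain] with s hs hBs hw
    push Not at hw
    obtain ⟨w, hw⟩ := hw
    have hBpos : 0 < B s := by
      have h : ENNReal.ofReal (B s) ≠ 0 := hBs
      simpa using h
    have h1 := hs w
    have h2 := mul_lt_mul_of_pos_left hw hBpos
    change ε * B s < 3 * H * θ s
    linarith
  have hle : (Q.map fun t => t i).real {s | ¬ ∀ w : T i, -ε ≤ ∫ t, M.utilityDiff E i s w t ∂(KQ s)}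
      ≤ (Q.map fun t => t i).real bad :=
    ENNReal.toReal_mono (measure_ne_top _ _) (measure_mono_ae hsub)
  refine hle.trans ?_
  have hmass : (Q.map fun t => t i).real bad = ∫ s in bad, B s ∂ρi := by
    rw [hQm, measureReal_def, withDensity_apply _ hbadm,
      integral_eq_lintegral_of_nonneg_ae (Filter.Eventually.of_forall hB0)
        hBm.aestronglyMeasurable]
  have h1 : ε * ∫ s in bad, B s ∂ρi ≤ 3 * H * (2 * δ) := by
    calc ε * ∫ s in bad, B s ∂ρi = ∫ s in bad, ε * B s ∂ρi := (integral_const_mul _ _).symm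
      _ ≤ ∫ s in bad, 3 * H * θ s ∂ρi :=
          setIntegral_mono_on (hBint.const_mul _).integrableOn (hθint.const_mul _).integrableOn
            hbadm fun s hs => le_of_lt hs
      _ ≤ ∫ s, 3 * H * θ s ∂ρi := setIntegral_le_integral (hθint.const_mul _)
          (Filter.Eventually.of_forall fun s => mul_nonneg (by linarith) (hθ0 s))
      _ = 3 * H * ∫ s, θ s ∂ρi := integral_const_mul _ _
      _ ≤ 3 * H * (2 * δ) := mul_le_mul_of_nonneg_left hθ (by linarith)
  rw [hmass]
  have h2 : 8 * H * δ * ∫ s in bad, B s ∂ρi ≤ 6 * H * δ * q := by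
    rw [hε, div_mul_eq_mul_div, div_le_iff₀ hq] at h1
    linarith
  have h3 : 0 < H * δ := mul_pos hH hδ0
  nlinarith

/-- The mechanism that chooses a fixed allocation without payments. -/
noncomputable def Mechanism.const (hH : 0 ≤ H) (A : X) : Mechanism T X H where
  alloc := Kernel.const _ (Measure.dirac A)
  isMarkovKernel_alloc := inferInstance
  pay := fun _ _ => 0
  measurable_pay := fun _ => measurable_const
  pay_mem := fun _ _ => ⟨by linarith, hH⟩

omit [∀ i, StandardBorelSpace (T i)] [∀ i, Nonempty (T i)] in
lemma Mechanism.isExPostIR_const (hH : 0 ≤ H) (A : X) :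
    (Mechanism.const hH A : Mechanism T X H).IsExPostIR E := by
  intro i t
  simp only [Mechanism.utility, Mechanism.const, sub_zero]
  exact integral_nonneg fun A => E.val_nonneg i _ A

lemma Mechanism.isBIC_const (hH : 0 ≤ H) (A : X) (P : Measure (∀ i, T i))
    [IsProbabilityMeasure P] : (Mechanism.const hH A : Mechanism T X H).IsBIC E P := by
  intro i
  refine Filter.Eventually.of_forall fun ti wi => ?_
  simp [Mechanism.interimDiff, Mechanism.utilityDiff, Mechanism.utility, Mechanism.const]

lemma Environment.rev_le_opt (P : Measure (∀ i, T i)) [IsProbabilityMeasure P]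
    {M : Mechanism T X H} (hIR : M.IsExPostIR E) (hBIC : M.IsBIC E P) : M.rev P ≤ E.opt P :=
  le_csSup ⟨n * H, by rintro _ ⟨M, -, -, rfl⟩; exact M.rev_le P⟩ ⟨M, hIR, hBIC, rfl⟩

lemma Environment.opt_le [Nonempty X] (hH : 0 ≤ H) (P : Measure (∀ i, T i))
    [IsProbabilityMeasure P] {C : ℝ}
    (h : ∀ M : Mechanism T X H, M.IsExPostIR E → M.IsBIC E P → M.rev P ≤ C) : E.opt P ≤ C := by
  obtain ⟨A⟩ := ‹Nonempty X›
  refine csSup_le ⟨_, Mechanism.const hH A, Mechanism.isExPostIR_const E hH A,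
    Mechanism.isBIC_const E hH A P, rfl⟩ ?_
  rintro _ ⟨M, h1, h2, rfl⟩
  exact h M h1 h2

/-- **Robustness of the optimal revenue.** Moving from an arbitrary distribution to a nearby product
distribution decreases the optimal revenue only slightly. -/
theorem Environment.opt_le_opt_pi [Nonempty X] (hH : 0 < H) (hsep : E.SeparableValuations)
    (D : Measure (∀ i, T i)) [IsProbabilityMeasure D] (μ : ∀ i, Measure (T i))
    [∀ i, IsProbabilityMeasure (μ i)] :
    E.opt D ≤ E.opt (Measure.pi μ) + 14 * (n * H) * √√(tvDist D (Measure.pi μ)) := by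
  rcases eq_or_lt_of_le (tvDist_nonneg D (Measure.pi μ)) with h0 | hδ0
  · have := eq_of_tvDist_eq_zero _ _ h0.symm
    subst this
    rw [← h0]
    simp
  have hδ1 := tvDist_le_one D (Measure.pi μ)
  refine E.opt_le hH.le D fun M hIR hBIC => ?_
  have hrev := (abs_le.1 (M.abs_rev_sub_rev_le D (Measure.pi μ))).2
  have hle : tvDist D (Measure.pi μ) ≤ tvDist D (Measure.pi μ) := le_rfl
  have happ := fun q (hq : 0 < q) => hBIC.isApproxBIC_of_tvDist_le hH hle (q := q) hq
  generalize tvDist D (Measure.pi μ) = δ at *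
  -- `q = √δ` balances the two error terms, and `η = √q` balances the rebate with the loss
  set q := √δ with hq
  have hq0 : 0 < q := Real.sqrt_pos.2 hδ0
  have hqq : q * q = δ := Real.mul_self_sqrt hδ0.le
  set η := √q with hη
  have hη0 : 0 < η := Real.sqrt_pos.2 hq0
  have hηη : η * η = q := Real.mul_self_sqrt hq0.le
  have hq1 : q ≤ 1 := Real.sqrt_le_one.2 hδ1
  have hη1 : η ≤ 1 := Real.sqrt_le_one.2 hq1
  have hε : 8 * H * δ / q = 8 * H * q := by rw [← hqq]; field_simp
  have h1 := happ q hq0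
  rw [hε] at h1
  obtain ⟨M', hIR', hBIC', hM'⟩ := M.exists_isBIC_of_isApproxBIC μ E hH hsep hIR (by positivity)
    h1 hη0 hη1 (κ := H * q) (by positivity)
  have h2 := E.rev_le_opt (Measure.pi μ) hIR' hBIC'
  have h3 : (8 * H * q + 2 * H * q + H * q) / η = 11 * H * η := by
    rw [div_eq_iff hη0.ne', mul_assoc (11 * H), hηη]; ring
  rw [h3] at hM'
  have h4 : δ ≤ η := by nlinarith
  have h5 : 0 ≤ (n : ℝ) * H := by positivity
  have h6 := mul_le_mul_of_nonneg_left h4 h5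
  linarith

end Robustness

theorem mainTheorem4 :
    ∃ C : ℝ, ∀ (n : ℕ) (T : Fin n → Type u) [∀ i, MeasurableSpace (T i)]
      [∀ i, StandardBorelSpace (T i)] [∀ i, Nonempty (T i)] (X : Type v) [MeasurableSpace X]
      (H : ℝ) (_ : 0 < H) (E : Environment T X H)
      (D : Measure (∀ i, T i)) [IsProbabilityMeasure D]
      (μ : ∀ i, Measure (T i)) [∀ i, IsProbabilityMeasure (μ i)]
      (δ : ℝ) (_ : tvDist D (Measure.pi μ) ≤ δ)
      (α : ℝ) (_ : 0 ≤ α)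
      (M : Mechanism T X H) (_ : M.IsExPostIR E) (_ : M.IsBIC E (Measure.pi μ))
      (_ : α * E.opt (Measure.pi μ) ≤ M.rev (Measure.pi μ)),
      M.IsExPostIR E ∧
      (∀ q : ℝ, 0 < q → q ≤ 1 → M.IsApproxBIC E D (8 * H * δ / q) q) ∧
      (E.SeparableValuations →
        α * E.opt D - C * ((1 + α) * (2 * n * H) * √(n * √δ)) ≤ M.rev D) := by
  refine ⟨7, ?_⟩
  intro n T _ _ _ X _ H hH E D _ μ _ δ hδ α hα M hIR hBIC hrev
  refine ⟨hIR, fun q hq _ => hBIC.isApproxBIC_of_tvDist_le hH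
    (by rw [tvDist_comm]; exact hδ) hq, fun hsep => ?_⟩
  have hX : Nonempty X := by
    have := M.isMarkovKernel_alloc
    exact nonempty_of_isProbabilityMeasure (M.alloc fun i => Classical.arbitrary (T i))
  have hopt := E.opt_le_opt_pi hH hsep D μ
  have hdiff := (abs_le.1 (M.abs_rev_sub_rev_le D (Measure.pi μ))).1
  have htv0 := tvDist_nonneg D (Measure.pi μ)
  have htv1 := tvDist_le_one D (Measure.pi μ)
  generalize tvDist D (Measure.pi μ) = τ at *
  have hτ : τ ≤ √√τ := by
    refine Real.le_sqrt_of_sq_le (Real.le_sqrt_of_sq_le ?_)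
    have h2 : τ ^ 2 ≤ 1 := pow_le_one₀ htv0 htv1
    nlinarith [sq_nonneg τ]
  have hnH : 0 ≤ (n : ℝ) * H := by positivity
  -- the inequality of the roots needs `1 ≤ n`, and for `n = 0` both sides vanish
  have hroot : n * H * √√τ ≤ n * H * √(n * √δ) := by
    rcases Nat.eq_zero_or_pos n with hn | hn
    · subst hn; simp
    · refine mul_le_mul_of_nonneg_left (Real.sqrt_le_sqrt ?_) hnH
      have h1 : (1 : ℝ) ≤ n := by exact_mod_cast hn
      have h2 : √τ ≤ √δ := Real.sqrt_le_sqrt hδ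
      nlinarith [Real.sqrt_nonneg δ]
  have h1 := mul_le_mul_of_nonneg_left hopt hα
  have h2 := mul_le_mul_of_nonneg_left hroot hα
  have h3 := mul_le_mul_of_nonneg_left hτ hnH
  have h4 : 0 ≤ (n : ℝ) * H * √(n * √δ) := by positivity
  have h5 : α * E.opt D - 7 * ((1 + α) * (2 * n * H) * √(n * √δ)) =
      α * E.opt D - 14 * (n * H * √(n * √δ)) - 14 * (α * (n * H * √(n * √δ))) := by ring
  have h6 : α * (E.opt (Measure.pi μ) + 14 * (n * H) * √√τ) =
      α * E.opt (Measure.pi μ) + 14 * (α * (n * H * √√τ)) := by ring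
  rw [h5]
  rw [h6] at h1
  linarith
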